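/- Let $\Lambda$ be a finite set of spins of local dimension $d\ge 1$, and let $H=\sum_{X\subseteq\Lambda}h_X$ be a Hamiltonian on $(\mathbb C^d)^{\otimes\Lambda}$, where each $h_X\ge 0$ acts only on the spins in $X$, $h_X=0$ for $|X|>k$, and $\sum_{X\ni i}\|h_X\|\le g$ for every $i\in\Lambda$. Put $\lambda=\frac1{2gk}$ and assume $\lambda\le\frac12$ (i.e. $gk\ge1$). For $L\subseteq\Lambda$ write $H=H_L+H_\partial+H_{L^c}$, where $H_L$, $H_{L^c}$ and $H_\partial$ are the sums of the $h_X$ with $X$ inside $L$, inside $L^c$, and meeting both $L$ and $L^c$, respectively, and let $|\partial L|=\sum_{X}\|h_X\|$ over the $X$ meeting both $L$ and $L^c$. For $\tau>0$ let $P_I$ denote the spectral projections of $H_L$, and define $$\tilde H_L=H_LP_{[0,\tau)}+\tau P_{[\tau,\infty)},\qquad \tilde H=\tilde H_L+H_\partial+H_{L^c}.$$ Let $\Pi_I$ and $\tilde\Pi_I$ be the spectral projections of $H$ and $\tilde H$, let $\epsilon_0\le\epsilon_1\le\cdots$ and $\tilde\epsilon_0\le\tilde\epsilon_1\le\cdots$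 be the eigenvalues of $H$ and $\tilde H$ with multiplicity, and let $\epsilon_0(L)$ be the lowest eigenvalue of $H_L$. For a real number $\epsilon$ put $\Delta\tau=\tau-\epsilon_0(L)$, $\Delta\epsilon=\epsilon-\epsilon_0$ and $\Delta\tilde\epsilon=\epsilon-\tilde\epsilon_0$. Then, with $\|\cdot\|$ the operator norm: (i) $$\|(H-\tilde H)\Pi_{[0,\epsilon]}\|\le\frac{6}{\lambda^{3/2}}e^{-\lambda(\Delta\tau-\Delta\epsilon-3|\partial L|)},$$ and, whenever $\Delta\tau-\Delta\tilde\epsilon-33|\partial L|>0$ (that is, whenever the exponent below is negative), $$\|(H-\tilde H)\tilde\Pi_{[0,\epsilon]}\|\le\frac{6}{\lambda^{3/2}}e^{-\lambda(\Delta\tau-\Delta\tilde\epsilon-33|\partial L|)}.$$ (ii) For every $j$ with $\epsilon_j\le\epsilon$, $$\epsilon_j-\frac{6}{\lambda^{3/2}}e^{-\lambda(\Delta\tau-\Delta\tilde\epsilon-33|\partial L|)}\le\tilde\epsilon_j\le\epsilon_j.$$ -/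

import Mathlib

open scoped Matrix.Norms.L2Operator ComplexOrder

noncomputable section

/-- Basis configurations of the spins on `Λ`, each of local dimension `d`; the Hilbert space
`(ℂ ^ d) ^ ⊗ Λ` is `ℂ ^ (Config Λ d)`. -/
abbrev Config (Λ : Type*) (d : ℕ) : Type _ := Λ → Fin d

/-- Operators on the Hilbert space of the spins, as matrices in the product basis. The norm `‖·‖`
on them is the operator norm with respect to the Hilbert space norm. -/
abbrev Op (Λ : Type*) (d : ℕ) : Type _ := Matrix (Config Λ d) (Config Λ d) ℂ

/-- `M` acts only on the particles in `X`: it is of the form `A ⊗ 1` with `A` an operator on the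
spins in `X` and `1` the identity on the other spins. -/
def SupportedOn {Λ : Type*} [Fintype Λ] [DecidableEq Λ] {d : ℕ} (X : Finset Λ) (M : Op Λ d) :
    Prop :=
  ∃ A : Op X d, ∀ σ σ' : Config Λ d,
    M σ σ' = if ∀ i, i ∉ X → σ i = σ' i then A (fun i => σ i) (fun i => σ' i) else 0

/-- A quantum spin system with non-negative interactions `h X`, each involving at most `k`
particles, such that the total strength of the interactions involving any one particle is at
most `g`. -/
structure SpinSystem (Λ : Type*) [Fintype Λ] [DecidableEq Λ] (d k : ℕ) (g : ℝ) where
  /-- the interaction terms -/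
  h : Finset Λ → Op Λ d
  supportedOn : ∀ X, SupportedOn X (h X)
  posSemidef : ∀ X, (h X).PosSemidef
  few_body : ∀ X, k < X.card → h X = 0
  strength_le : ∀ i : Λ, ∑ X with i ∈ X, ‖h X‖ ≤ g

/-- The spectral projection of a Hermitian matrix `A` onto the span of its eigenvectors with
eigenvalues in `I` (every function is continuous on the finite spectrum of `A`). -/
def spectralProj {n : Type*} [Fintype n] [DecidableEq n] (A : Matrix n n ℂ) (I : Set ℝ) :
    Matrix n n ℂ :=
  cfc (I.indicator (fun _ => (1 : ℝ))) A

/-- The eigenvalues of a Hermitian matrix in increasing order, with multiplicity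
(`Matrix.IsHermitian.eigenvalues₀` lists them in decreasing order). -/
def energyLevel {n : Type*} [Fintype n] [DecidableEq n] {A : Matrix n n ℂ} (hA : A.IsHermitian)
    (j : Fin (Fintype.card n)) : ℝ :=
  hA.eigenvalues₀ j.rev

/-- The lowest eigenvalue of a Hermitian matrix. -/
def groundEnergy {n : Type*} [Fintype n] [DecidableEq n] [Nonempty n] {A : Matrix n n ℂ}
    (hA : A.IsHermitian) : ℝ :=
  energyLevel hA ⟨0, Fintype.card_pos⟩

namespace SpinSystem

variable {Λ : Type*} [Fintype Λ] [DecidableEq Λ] {d k : ℕ} {g : ℝ}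

/-- The total Hamiltonian `H`. -/
def ham (S : SpinSystem Λ d k g) : Op Λ d := ∑ X, S.h X

/-- The interactions inside `L`. -/
def inside (L : Finset Λ) : Finset (Finset Λ) := {X | X ⊆ L}

/-- The interactions inside the complement of `L`. (A constant term, `X = ∅`, is counted as
being inside `L`, so that the three classes are disjoint.) -/
def outside (L : Finset Λ) : Finset (Finset Λ) := {X | ¬ X ⊆ L ∧ X ⊆ Lᶜ}

/-- The interactions involving both particles in `L` and particles in its complement. -/
def boundary (L : Finset Λ) : Finset (Finset Λ) := {X | ¬ X ⊆ L ∧ ¬ X ⊆ Lᶜ}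

/-- `H_L`. -/
def hamIn (S : SpinSystem Λ d k g) (L : Finset Λ) : Op Λ d := ∑ X ∈ inside L, S.h X

/-- `H_{Lᶜ}`. -/
def hamOut (S : SpinSystem Λ d k g) (L : Finset Λ) : Op Λ d := ∑ X ∈ outside L, S.h X

/-- `H_∂`. -/
def hamBd (S : SpinSystem Λ d k g) (L : Finset Λ) : Op Λ d := ∑ X ∈ boundary L, S.h X

/-- `|∂L|`, the total strength of the boundary interactions. -/
def bdSize (S : SpinSystem Λ d k g) (L : Finset Λ) : ℝ := ∑ X ∈ boundary L, ‖S.h X‖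

/-- `H_L` with its energies capped at `τ`. -/
def truncIn (S : SpinSystem Λ d k g) (L : Finset Λ) (τ : ℝ) : Op Λ d :=
  S.hamIn L * spectralProj (S.hamIn L) (Set.Ico 0 τ) +
    (τ : ℂ) • spectralProj (S.hamIn L) (Set.Ici τ)

/-- The truncated Hamiltonian. -/
def truncHam (S : SpinSystem Λ d k g) (L : Finset Λ) (τ : ℝ) : Op Λ d :=
  S.truncIn L τ + S.hamBd L + S.hamOut L

theorem ham_eq (S : SpinSystem Λ d k g) (L : Finset Λ) :
    S.ham = S.hamIn L + S.hamBd L + S.hamOut L := by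
  have h1 := Finset.sum_filter_add_sum_filter_not (Finset.univ : Finset (Finset Λ))
    (fun X => X ⊆ L) S.h
  have h2 := Finset.sum_filter_add_sum_filter_not
    ((Finset.univ : Finset (Finset Λ)).filter fun X => ¬ X ⊆ L) (fun X => X ⊆ Lᶜ) S.h
  rw [Finset.filter_filter, Finset.filter_filter] at h2
  rw [← h2] at h1
  rw [ham, ← h1, hamIn, hamBd, hamOut, inside, outside, boundary]
  abel

theorem isHermitian_sum (S : SpinSystem Λ d k g) (E : Finset (Finset Λ)) :
    (∑ X ∈ E, S.h X).IsHermitian := by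
  rw [Matrix.IsHermitian, Matrix.conjTranspose_sum]
  exact Finset.sum_congr rfl fun X _ => (S.posSemidef X).isHermitian

theorem ham_isHermitian (S : SpinSystem Λ d k g) : S.ham.IsHermitian :=
  S.isHermitian_sum Finset.univ

theorem hamIn_isHermitian (S : SpinSystem Λ d k g) (L : Finset Λ) : (S.hamIn L).IsHermitian :=
  S.isHermitian_sum (inside L)

theorem truncHam_isHermitian (S : SpinSystem Λ d k g) (L : Finset Λ) (τ : ℝ) :
    (S.truncHam L τ).IsHermitian := by
  have hP : ∀ I, IsSelfAdjoint (spectralProj (S.hamIn L) I) := fun I => cfc_predicate _ _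
  have hL : IsSelfAdjoint (S.hamIn L) := S.hamIn_isHermitian L
  have hc : Commute (S.hamIn L) (spectralProj (S.hamIn L) (Set.Ico 0 τ)) := by
    have := cfc_commute_cfc (fun x : ℝ => x) ((Set.Ico 0 τ).indicator fun _ => (1 : ℝ)) (S.hamIn L)
    rwa [cfc_id' ℝ (S.hamIn L) hL] at this
  have h1 : IsSelfAdjoint (S.hamIn L * spectralProj (S.hamIn L) (Set.Ico 0 τ)) :=
    (hL.commute_iff (hP _)).mp hc
  have h2 : IsSelfAdjoint ((τ : ℂ) • spectralProj (S.hamIn L) (Set.Ici τ)) :=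
    IsSelfAdjoint.smul (by simp [isSelfAdjoint_iff]) (hP _)
  exact ((h1.add h2).add (S.isHermitian_sum (boundary L))).add (S.isHermitian_sum (outside L))

end SpinSystem

end

/-! Write A = H_L, B = H_∂, C = H_{Lᶜ} and b = |∂L|; A and C commute. Then H - H̃ = A - min(A, τ),
and x - min(x, τ) ≤ λ⁻¹ e^{λ(x - τ)}, so ‖(H - H̃)P‖ ≤ λ⁻¹ e^{-λτ} ‖e^{λA} P‖ for every P. It
remains to show that low-energy states have exponentially small weight at high energies of A.

The locality input is `norm_exp_conj_hamBd_le`: n-fold commutators of an interaction term with a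
local Hamiltonian grow at most like (gk)ⁿ n!, so conjugation by e^{sG} with s ≤ λ = 1/(2gk), half
the guaranteed radius of convergence, takes B to an operator of norm at most 2b.

For P = Π_{[0,ε]}, the product e^{λ(A+C)} e^{-λH} is compared with 1 by Grönwall's inequality
(`norm_exp_mul_spectralProj_le`). For H̃ this fails, since min(A, τ) is not a sum of local terms.
Instead, the part X of e^{λA} P̃ on A ≥ a solves a Sylvester equation whose two coefficients have
separated spectra and whose source is e^{λA} B e^{-λA} · e^{λA} P̃ cut to A ≥ a. With a gap above 4b
the source, of size 2b, is absorbed (`norm_exp_mul_spectralProj_truncated_le`). Only conjugation by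
the local A enters.

The ground energy of C is removed by a product trial state: ε₀ ≤ ε₀(L) + ε₀(Lᶜ) + b. Part (ii) is
min-max: H̃ ≤ H gives one side, and the norm bound on low-energy states of H̃ gives the other. The
argument yields prefactors of order 1/λ, and λ^{3/2} ≤ λ; the 33 also leaves room, as 5 boundary
terms arise. -/

noncomputable section

/-! ### Imaginary-time conjugation and Grönwall's inequality in a Banach algebra -/

section BanachAlgebra

variable {𝔸 : Type*} [NormedRing 𝔸] [NormedAlgebra ℂ 𝔸]

/-- The commutator with `G`, as a bounded operator. -/
def adCLM (G : 𝔸) : 𝔸 →L[ℂ] 𝔸 :=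
  ContinuousLinearMap.mul ℂ 𝔸 G - (ContinuousLinearMap.mul ℂ 𝔸).flip G

theorem adCLM_apply (G O : 𝔸) : adCLM G O = G * O - O * G := by
  simp [adCLM]

variable [CompleteSpace 𝔸]

theorem exp_mulLeft_apply (G O : 𝔸) :
    NormedSpace.exp (ContinuousLinearMap.mul ℂ 𝔸 G) O = NormedSpace.exp G * O := by
  have h1 := (NormedSpace.exp_series_hasSum_exp' (𝕂 := ℂ) (ContinuousLinearMap.mul ℂ 𝔸 G)).mapL
    (ContinuousLinearMap.apply ℂ 𝔸 O)
  have h2 := (NormedSpace.exp_series_hasSum_exp' (𝕂 := ℂ) G).mul_right O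
  refine h1.unique (h2.congr_fun ?_)
  intro n
  have : ∀ n : ℕ, ((ContinuousLinearMap.mul ℂ 𝔸 G) ^ n) O = G ^ n * O := by
    intro n
    induction n with
    | zero => simp
    | succ n ih => rw [pow_succ', mul_apply_eq_comp, ih, pow_succ', mul_assoc]; rfl
  simp [this]

theorem exp_mulRight_apply (G O : 𝔸) :
    NormedSpace.exp ((ContinuousLinearMap.mul ℂ 𝔸).flip G) O = O * NormedSpace.exp G := by
  have h1 := (NormedSpace.exp_series_hasSum_exp' (𝕂 := ℂ)
    ((ContinuousLinearMap.mul ℂ 𝔸).flip G)).mapL (ContinuousLinearMap.apply ℂ 𝔸 O)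
  have h2 := (NormedSpace.exp_series_hasSum_exp' (𝕂 := ℂ) G).mul_left O
  refine h1.unique (h2.congr_fun ?_)
  intro n
  have : ∀ n : ℕ, (((ContinuousLinearMap.mul ℂ 𝔸).flip G) ^ n) O = O * G ^ n := by
    intro n
    induction n with
    | zero => simp
    | succ n ih => rw [pow_succ', mul_apply_eq_comp, ih, pow_succ, ← mul_assoc]; rfl
  simp [this]

theorem exp_add_of_commute_complex {x y : 𝔸} (h : Commute x y) :
    NormedSpace.exp (x + y) = NormedSpace.exp x * NormedSpace.exp y := by
  let +nondep : NormedAlgebra ℚ 𝔸 := .restrictScalars ℚ ℂ 𝔸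
  exact NormedSpace.exp_add_of_commute h

theorem exp_neg_mul_exp (x : 𝔸) : NormedSpace.exp (-x) * NormedSpace.exp x = 1 := by
  rw [← exp_add_of_commute_complex ((Commute.refl _).neg_left), neg_add_cancel,
    NormedSpace.exp_zero]

/-- Left and right multiplication by G commute, so the exponential of their difference factors. -/
theorem exp_adCLM_apply (G O : 𝔸) :
    NormedSpace.exp (adCLM G) O = NormedSpace.exp G * O * NormedSpace.exp (-G) := by
  have hc : Commute (ContinuousLinearMap.mul ℂ 𝔸 G) (-(ContinuousLinearMap.mul ℂ 𝔸).flip G) := by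
    ext x
    simp [mul_assoc]
  have hneg : -(ContinuousLinearMap.mul ℂ 𝔸).flip G = (ContinuousLinearMap.mul ℂ 𝔸).flip (-G) := by
    ext x; simp
  rw [adCLM, sub_eq_add_neg, exp_add_of_commute_complex hc, mul_apply_eq_comp,
    exp_mulLeft_apply, hneg, exp_mulRight_apply, mul_assoc]

/-- If the iterated commutators of `O` with `G` grow at most like `c rⁿ n!`, then
conjugating `O` by `exp (s G)` costs at most a factor `1 / (1 - s r)`. -/
theorem norm_exp_conj_le {G O : 𝔸} {c r s : ℝ} (hs : 0 ≤ s) (hr : 0 ≤ r) (hsr : s * r < 1)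
    (h : ∀ n : ℕ, ‖(adCLM G ^ n) O‖ ≤ c * (r ^ n * n.factorial)) :
    ‖NormedSpace.exp ((s : ℂ) • G) * O * NormedSpace.exp (-((s : ℂ) • G))‖ ≤ c / (1 - s * r) := by
  rw [← exp_adCLM_apply]
  have h1 := (NormedSpace.exp_series_hasSum_exp' (𝕂 := ℂ) (adCLM ((s : ℂ) • G))).mapL
    (ContinuousLinearMap.apply ℂ 𝔸 O)
  have had : ∀ n : ℕ, (adCLM ((s : ℂ) • G) ^ n) O = (s : ℂ) ^ n • (adCLM G ^ n) O := by
    intro n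
    induction n with
    | zero => simp
    | succ n ih =>
      rw [pow_succ', mul_apply_eq_comp, ih, pow_succ' (adCLM G),
        mul_apply_eq_comp, map_smul, adCLM_apply, adCLM_apply, pow_succ, mul_smul]
      simp [smul_sub]
  have h2 : HasSum (fun n : ℕ => c * (s * r) ^ n) (c / (1 - s * r)) := by
    rw [div_eq_mul_inv]
    exact (hasSum_geometric_of_lt_one (mul_nonneg hs hr) hsr).mul_left c
  have h3 := tsum_of_norm_bounded h2 (f := fun n : ℕ => (ContinuousLinearMap.apply ℂ 𝔸 O)
    ((n.factorial : ℂ)⁻¹ • adCLM ((s : ℂ) • G) ^ n)) ?_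
  · rw [h1.tsum_eq] at h3
    simpa using h3
  · intro n
    simp only [map_smul, ContinuousLinearMap.apply_apply, had, norm_smul, norm_inv, norm_pow,
      Complex.norm_natCast, Complex.norm_real, Real.norm_eq_abs, abs_of_nonneg hs]
    calc _ ≤ (n.factorial : ℝ)⁻¹ * (s ^ n * (c * (r ^ n * n.factorial))) := by
          gcongr; exact h n
      _ = c * (s * r) ^ n := by
          have : (n.factorial : ℝ) ≠ 0 := by positivity
          rw [mul_pow]; field_simp

/-- Interaction picture estimate: if conjugating `B` by `exp (t G)` gives operators of norm at most
`β` for `0 ≤ t ≤ T`, then `exp (T G)` and `exp (-T (G + B))` almost cancel. -/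
theorem norm_exp_mul_exp_neg_add_le [NormOneClass 𝔸] {G B : 𝔸} {β T : ℝ} (hT : 0 ≤ T)
    (h : ∀ t : ℝ, 0 ≤ t → t ≤ T →
      ‖NormedSpace.exp ((t : ℂ) • G) * B * NormedSpace.exp (-((t : ℂ) • G))‖ ≤ β) :
    ‖NormedSpace.exp ((T : ℂ) • G) * NormedSpace.exp (-((T : ℂ) • (G + B)))‖ ≤
      Real.exp (β * T) := by
  have hd : ∀ (K : 𝔸) (t : ℝ), HasDerivAt (fun u : ℝ => NormedSpace.exp ((u : ℂ) • K))
      (NormedSpace.exp ((t : ℂ) • K) * K) t := by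
    intro K t
    exact ((hasDerivAt_exp_smul_const (𝕂 := ℂ) K (t : ℂ)).scomp t
      Complex.ofRealCLM.hasDerivAt).congr_deriv (by simp)
  have hd' : ∀ (K : 𝔸) (t : ℝ), HasDerivAt (fun u : ℝ => NormedSpace.exp ((u : ℂ) • K))
      (K * NormedSpace.exp ((t : ℂ) • K)) t := by
    intro K t
    exact ((hasDerivAt_exp_smul_const' (𝕂 := ℂ) K (t : ℂ)).scomp t
      Complex.ofRealCLM.hasDerivAt).congr_deriv (by simp)
  set F : ℝ → 𝔸 := fun t => NormedSpace.exp ((t : ℂ) • G) * NormedSpace.exp ((t : ℂ) • (-(G + B)))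
    with hF
  set F' : ℝ → 𝔸 := fun t => -(NormedSpace.exp ((t : ℂ) • G) * B *
    NormedSpace.exp (-((t : ℂ) • G))) * F t with hF'
  have hFd : ∀ t, HasDerivAt F (F' t) t := by
    intro t
    have := (hd G t).mul (hd' (-(G + B)) t)
    refine this.congr_deriv ?_
    simp only [hF', hF]
    -- The G-terms cancel; inserting e^{-tG} e^{tG} = 1 after B turns what is left into a linear
    -- equation for F whose coefficient is the conjugated B.
    calc NormedSpace.exp ((t : ℂ) • G) * G * NormedSpace.exp ((t : ℂ) • -(G + B)) +
          NormedSpace.exp ((t : ℂ) • G) * (-(G + B) * NormedSpace.exp ((t : ℂ) • -(G + B)))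
        = -(NormedSpace.exp ((t : ℂ) • G) * B * 1 * NormedSpace.exp ((t : ℂ) • -(G + B))) := by
          noncomm_ring
      _ = -(NormedSpace.exp ((t : ℂ) • G) * B * (NormedSpace.exp (-((t : ℂ) • G)) *
          NormedSpace.exp ((t : ℂ) • G)) * NormedSpace.exp ((t : ℂ) • (-(G + B)))) := by
          rw [exp_neg_mul_exp]
      _ = _ := by noncomm_ring
  have := norm_le_gronwallBound_of_norm_deriv_right_le (f := F) (f' := F') (δ := 1) (K := β)
    (ε := 0) (a := 0) (b := T) (fun t _ => (hFd t).continuousAt.continuousWithinAt)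
    (fun t _ => (hFd t).hasDerivWithinAt) (by simp [hF]) ?_ T ⟨hT, le_rfl⟩
  · rw [gronwallBound_ε0] at this
    simpa [hF] using this
  · intro t ht
    rw [add_zero]
    simp only [hF']
    refine (norm_mul_le _ _).trans ?_
    rw [norm_neg]
    gcongr
    exact h t ht.1 ht.2.le

end BanachAlgebra

/-- Shifting h by the scalar ‖h‖/2 leaves the commutator unchanged and halves the norm, because the
spectrum lies in [0, ‖h‖]. This saves the usual factor 2. -/
theorem norm_commutator_le_of_posSemidef {n : Type*} [Fintype n] [DecidableEq n] [Nonempty n]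
    {h O : Matrix n n ℂ} (hh : h.PosSemidef) : ‖h * O - O * h‖ ≤ ‖h‖ * ‖O‖ := by
  have hsa : IsSelfAdjoint h := hh.isHermitian
  have h1 : ‖h - algebraMap ℝ _ (‖h‖ / 2)‖ ≤ ‖h‖ / 2 := by
    have : h - algebraMap ℝ _ (‖h‖ / 2) = cfc (fun x : ℝ => x - ‖h‖ / 2) h := by
      rw [cfc_sub (fun x : ℝ => x) (fun _ => ‖h‖ / 2) h, cfc_id' ℝ h, cfc_const (‖h‖ / 2) h]
    rw [this]
    refine norm_cfc_le (by positivity) fun x hx => ?_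
    have hx0 : (0 : ℂ) ≤ (x : ℂ) :=
      (Matrix.posSemidef_iff_isHermitian_and_spectrum_nonneg.mp hh).2 hx
    rw [Complex.zero_le_real] at hx0
    have hx1 : ‖x‖ ≤ ‖h‖ := spectrum.norm_le_norm_of_mem hx
    rw [Real.norm_eq_abs] at *
    rw [abs_le] at *
    constructor <;> linarith
  have h2 : h * O - O * h =
      (h - algebraMap ℝ _ (‖h‖ / 2)) * O - O * (h - algebraMap ℝ _ (‖h‖ / 2)) := by
    rw [sub_mul, mul_sub, Algebra.commutes (‖h‖ / 2) O]
    abel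
  rw [h2]
  calc _ ≤ ‖(h - algebraMap ℝ _ (‖h‖ / 2)) * O‖ + ‖O * (h - algebraMap ℝ _ (‖h‖ / 2))‖ :=
        norm_sub_le _ _
    _ ≤ ‖h‖ / 2 * ‖O‖ + ‖O‖ * (‖h‖ / 2) := by
        gcongr
        · exact (norm_mul_le _ _).trans (by gcongr)
        · exact (norm_mul_le _ _).trans (by gcongr)
    _ = _ := by ring

/-! ### Locality and the growth of nested commutators -/

section Support

variable {Λ : Type*} [Fintype Λ] [DecidableEq Λ] {d : ℕ}

/-- In either product only one intermediate configuration contributes: the one in which exactly the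
spins of X, or exactly those outside X, have already been changed. -/
theorem SupportedOn.commute {X Z : Finset Λ} (hXZ : Disjoint X Z) {M N : Op Λ d}
    (hM : SupportedOn X M) (hN : SupportedOn Z N) : Commute M N := by
  have hd : ∀ i, i ∈ X → i ∉ Z := fun i hi => Finset.disjoint_left.mp hXZ hi
  obtain ⟨A, hA⟩ := hM
  obtain ⟨A', hA'⟩ := hN
  ext σ σ'
  rw [Matrix.mul_apply, Matrix.mul_apply,
    Finset.sum_eq_single (X.piecewise σ' σ), Finset.sum_eq_single (X.piecewise σ σ')]
  · have e1 : (fun i : X => X.piecewise σ' σ i) = fun i : X => σ' i := by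
      ext i; simp
    have e2 : (fun i : X => X.piecewise σ σ' i) = fun i : X => σ i := by
      ext i; simp
    have e3 : (fun i : Z => X.piecewise σ' σ i) = fun i : Z => σ i := by
      ext i; rw [Finset.piecewise_eq_of_notMem _ _ _ fun h => hd i h i.2]
    have e4 : (fun i : Z => X.piecewise σ σ' i) = fun i : Z => σ' i := by
      ext i; rw [Finset.piecewise_eq_of_notMem _ _ _ fun h => hd i h i.2]
    have h1 : ∀ i, i ∉ X → σ i = X.piecewise σ' σ i := fun i hi => by simp [hi]
    have h2 : ∀ i, i ∉ X → X.piecewise σ σ' i = σ' i := fun i hi => by simp [hi]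
    have h3 : (∀ i, i ∉ Z → X.piecewise σ' σ i = σ' i) ↔
        ∀ i, i ∉ Z → σ i = X.piecewise σ σ' i := by
      refine forall_congr' fun i => ?_
      by_cases hi : i ∈ X <;> simp [hi]
    rw [hA, hA, hA', hA', e1, e2, e3, e4, if_pos h1, if_pos h2, mul_comm]
    simp only [h3]
  · intro ρ _ hρ
    rw [hA, hA']
    by_cases h1 : ∀ i, i ∉ Z → σ i = ρ i
    · rw [if_neg (c := ∀ i, i ∉ X → ρ i = σ' i), mul_zero]
      intro h2
      refine hρ (funext fun i => ?_)
      by_cases hi : i ∈ X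
      · simp [hi, h1 i (hd i hi)]
      · simp [hi, h2 i hi]
    · rw [if_neg h1, zero_mul]
  · simp
  · intro ρ _ hρ
    rw [hA, hA']
    by_cases h1 : ∀ i, i ∉ X → σ i = ρ i
    · rw [if_neg (c := ∀ i, i ∉ Z → ρ i = σ' i), mul_zero]
      intro h2
      refine hρ (funext fun i => ?_)
      by_cases hi : i ∈ X
      · simp [hi, h2 i (hd i hi)]
      · simp [hi, h1 i hi]
    · rw [if_neg h1, zero_mul]
  · simp

end Support

namespace SpinSystem

variable {Λ : Type*} [Fintype Λ] [DecidableEq Λ] {d k : ℕ} {g : ℝ}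

theorem commute_h (S : SpinSystem Λ d k g) {X Z : Finset Λ} (hXZ : Disjoint X Z) :
    Commute (S.h X) (S.h Z) :=
  (S.supportedOn X).commute hXZ (S.supportedOn Z)

/-- A union bound over the sites of Y, each of which carries strength at most g. -/
theorem sum_norm_h_meeting_le (S : SpinSystem Λ d k g) (hg : 0 ≤ g) (E : Finset (Finset Λ))
    {Y : Finset Λ} {m : ℕ} (hY : Y.card ≤ k * m) :
    ∑ X ∈ E with ¬ Disjoint X Y, ‖S.h X‖ ≤ g * k * m := by
  calc ∑ X ∈ E with ¬ Disjoint X Y, ‖S.h X‖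
      ≤ ∑ X ∈ E with ¬ Disjoint X Y, ∑ i ∈ Y, if i ∈ X then ‖S.h X‖ else 0 := by
        refine Finset.sum_le_sum fun X hX => ?_
        obtain ⟨i, hi, hi'⟩ := Finset.not_disjoint_iff.mp (Finset.mem_filter.mp hX).2
        refine (if_pos hi).ge.trans (Finset.single_le_sum
          (f := fun i => if i ∈ X then ‖S.h X‖ else 0) (fun j _ => ?_) hi')
        positivity
    _ ≤ ∑ X, ∑ i ∈ Y, if i ∈ X then ‖S.h X‖ else 0 :=
        Finset.sum_le_sum_of_subset_of_nonneg (Finset.subset_univ _) fun _ _ _ =>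
          Finset.sum_nonneg fun _ _ => by positivity
    _ = ∑ i ∈ Y, ∑ X with i ∈ X, ‖S.h X‖ := by
        rw [Finset.sum_comm]
        simp_rw [Finset.sum_filter]
    _ ≤ ∑ i ∈ Y, g := Finset.sum_le_sum fun i _ => S.strength_le i
    _ = Y.card * g := by simp
    _ ≤ (k * m : ℕ) * g := by gcongr
    _ = g * k * m := by push_cast; ring

/-- Iterated commutators with a local Hamiltonian of an operator commuting with all
interactions away from a region `Y` of at most `k m` particles. -/
theorem norm_ad_pow_le [NeZero d] (S : SpinSystem Λ d k g) (hg : 0 ≤ g) (E : Finset (Finset Λ))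
    (n : ℕ) : ∀ (m : ℕ) (O : Op Λ d) (Y : Finset Λ), Y.card ≤ k * m →
      (∀ Z, Disjoint Z Y → Commute (S.h Z) O) →
      ‖(adCLM (∑ X ∈ E, S.h X) ^ n) O‖ ≤ ‖O‖ * ((g * k) ^ n * m.ascFactorial n) := by
  induction n with
  | zero => intro m O Y _ _; simp
  | succ n ih =>
    intro m O Y hY hO
    have hgk : 0 ≤ g * k := by positivity
    have h1 : adCLM (∑ X ∈ E, S.h X) O =
        ∑ X ∈ E with ¬ Disjoint X Y, (S.h X * O - O * S.h X) := by
      rw [adCLM_apply, Finset.sum_mul, Finset.mul_sum, ← Finset.sum_sub_distrib]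
      refine (Finset.sum_filter_of_ne (p := fun X => ¬ Disjoint X Y) fun X _ hX hXY => hX ?_).symm
      rw [(hO X hXY).eq, sub_self]
    -- The innermost commutator is peeled off, so that the induction hypothesis applies to each
    -- commutator with `S.h X`, on a region enlarged by at most k sites; hence m becomes m + 1.
    rw [pow_succ, mul_apply_eq_comp, h1, map_sum]
    calc _ ≤ ∑ X ∈ E with ¬ Disjoint X Y,
          ‖S.h X‖ * (‖O‖ * ((g * k) ^ n * (m + 1).ascFactorial n)) := by
          refine norm_sum_le_of_le _ fun X _ => ?_
          by_cases hX : S.h X = 0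
          · simp [hX]
          have hXk : X.card ≤ k := not_lt.mp fun h => hX (S.few_body X h)
          refine (ih (m + 1) _ (X ∪ Y) ?_ ?_).trans ?_
          · refine (Finset.card_union_le _ _).trans ?_
            rw [mul_add, mul_one]
            omega
          · intro Z hZ
            rw [Finset.disjoint_union_right] at hZ
            have hc := S.commute_h hZ.1
            exact (hc.mul_right (hO Z hZ.2)).sub_right ((hO Z hZ.2).mul_right hc)
          · rw [← mul_assoc ‖S.h X‖]
            gcongr
            exact norm_commutator_le_of_posSemidef (S.posSemidef X)
      _ = (∑ X ∈ E with ¬ Disjoint X Y, ‖S.h X‖) *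
          (‖O‖ * ((g * k) ^ n * (m + 1).ascFactorial n)) := by rw [Finset.sum_mul]
      _ ≤ (g * k * m) * (‖O‖ * ((g * k) ^ n * (m + 1).ascFactorial n)) := by
          gcongr
          exact S.sum_norm_h_meeting_le hg E hY
      _ = _ := by
          have := Nat.succ_ascFactorial m n
          rw [← Nat.ascFactorial_succ] at this
          rw [← this]
          push_cast
          ring

/-- The term starts on its own support, so m = 1 and the rising factorial is n!. The exponential
series is then dominated by a geometric series of ratio s g k ≤ 1/2, whose sum is at most 2. -/
theorem norm_exp_conj_h_le [NeZero d] (S : SpinSystem Λ d k g) (hg : 0 ≤ g)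
    (E : Finset (Finset Λ)) {s : ℝ} (hs : 0 ≤ s) (hsgk : s * (g * k) ≤ 1 / 2) (X : Finset Λ) :
    ‖NormedSpace.exp ((s : ℂ) • ∑ X ∈ E, S.h X) * S.h X *
      NormedSpace.exp (-((s : ℂ) • ∑ X ∈ E, S.h X))‖ ≤ 2 * ‖S.h X‖ := by
  have hgk : 0 ≤ g * k := by positivity
  have h1 := norm_exp_conj_le (G := ∑ X ∈ E, S.h X) (O := S.h X) (c := ‖S.h X‖) hs hgk
    (hsgk.trans_lt (by norm_num)) ?_
  · refine h1.trans ?_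
    rw [div_le_iff₀ (by linarith)]
    nlinarith [norm_nonneg (S.h X)]
  · intro n
    by_cases hX : S.h X = 0
    · simp [hX]
    have hXk : X.card ≤ k := not_lt.mp fun h => hX (S.few_body X h)
    have := S.norm_ad_pow_le hg E n 1 (S.h X) X (by simpa using hXk) fun Z hZ => S.commute_h hZ
    simpa [Nat.one_ascFactorial] using this

/-- Imaginary time evolution up to time `1 / (2 g k)` under any part of the Hamiltonian at most
doubles the boundary interactions. -/
theorem norm_exp_conj_hamBd_le [NeZero d] (S : SpinSystem Λ d k g) (hg : 0 ≤ g)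
    (E : Finset (Finset Λ)) (L : Finset Λ) {s : ℝ} (hs : 0 ≤ s) (hsgk : s * (g * k) ≤ 1 / 2) :
    ‖NormedSpace.exp ((s : ℂ) • ∑ X ∈ E, S.h X) * S.hamBd L *
      NormedSpace.exp (-((s : ℂ) • ∑ X ∈ E, S.h X))‖ ≤ 2 * S.bdSize L := by
  rw [hamBd, bdSize, Finset.mul_sum, Finset.sum_mul, Finset.mul_sum]
  exact norm_sum_le_of_le _ fun X _ => S.norm_exp_conj_h_le hg E hs hsgk X

theorem norm_hamBd_le (S : SpinSystem Λ d k g) (L : Finset Λ) : ‖S.hamBd L‖ ≤ S.bdSize L :=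
  norm_sum_le _ _

end SpinSystem

/-! ### Quadratic forms -/

section QuadraticForm

variable {n : Type*} [Fintype n] [DecidableEq n]

/-- The quadratic form of a matrix, `ψ ↦ Re ⟨ψ, M ψ⟩`. -/
def energy (M : Matrix n n ℂ) (ψ : EuclideanSpace ℂ n) : ℝ :=
  (inner ℂ ψ (Matrix.toEuclideanCLM (𝕜 := ℂ) M ψ)).re

theorem energy_add (M N : Matrix n n ℂ) (ψ : EuclideanSpace ℂ n) :
    energy (M + N) ψ = energy M ψ + energy N ψ := by
  simp [energy]

theorem energy_sub (M N : Matrix n n ℂ) (ψ : EuclideanSpace ℂ n) :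
    energy (M - N) ψ = energy M ψ - energy N ψ := by
  simp [energy]

theorem norm_toEuclideanCLM_apply_le (M : Matrix n n ℂ) (ψ : EuclideanSpace ℂ n) :
    ‖Matrix.toEuclideanCLM (𝕜 := ℂ) M ψ‖ ≤ ‖M‖ * ‖ψ‖ :=
  (Matrix.toEuclideanCLM (𝕜 := ℂ) M).le_opNorm ψ

theorem energy_le_norm (M : Matrix n n ℂ) (ψ : EuclideanSpace ℂ n) :
    energy M ψ ≤ ‖M‖ * ‖ψ‖ ^ 2 := by
  calc energy M ψ ≤ ‖inner ℂ ψ (Matrix.toEuclideanCLM (𝕜 := ℂ) M ψ)‖ := Complex.re_le_norm _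
    _ ≤ ‖ψ‖ * (‖M‖ * ‖ψ‖) :=
        (norm_inner_le_norm _ _).trans (by gcongr; exact norm_toEuclideanCLM_apply_le M ψ)
    _ = _ := by ring

theorem energy_eq_sum {ι : Type*} [Fintype ι] (b : OrthonormalBasis ι ℂ (EuclideanSpace ℂ n))
    {M : Matrix n n ℂ} {μ : ι → ℝ}
    (h : ∀ i, Matrix.toEuclideanCLM (𝕜 := ℂ) M (b i) = (μ i : ℂ) • b i)
    (ψ : EuclideanSpace ℂ n) : energy M ψ = ∑ i, μ i * ‖inner ℂ (b i) ψ‖ ^ 2 := by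
  have h1 : Matrix.toEuclideanCLM (𝕜 := ℂ) M ψ = ∑ i, (inner ℂ (b i) ψ * μ i) • b i := by
    conv_lhs => rw [← b.sum_repr' ψ]
    simp only [map_sum, map_smul, h, smul_smul]
  rw [energy, h1, inner_sum, Complex.re_sum]
  refine Finset.sum_congr rfl fun i _ => ?_
  rw [inner_smul_right, ← inner_conj_symm ψ (b i), mul_right_comm, Complex.mul_conj,
    Complex.normSq_eq_norm_sq, ← Complex.ofReal_mul, Complex.ofReal_re, mul_comm]

end QuadraticForm

/-! ### Functional calculus of Hermitian matrices -/

section FunctionalCalculus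

variable {n : Type*} [Fintype n] [DecidableEq n] {A : Matrix n n ℂ}

theorem Matrix.continuousOn_spectrum (A : Matrix n n ℂ) (f : ℝ → ℝ) :
    ContinuousOn f (spectrum ℝ A) :=
  A.finite_real_spectrum.continuousOn f

theorem Matrix.cfc_mul_eq (A : Matrix n n ℂ) (f g : ℝ → ℝ) :
    cfc f A * cfc g A = cfc (fun x => f x * g x) A :=
  (cfc_mul f g A (A.continuousOn_spectrum f) (A.continuousOn_spectrum g)).symm

theorem Matrix.cfc_add_eq (A : Matrix n n ℂ) (f g : ℝ → ℝ) :
    cfc f A + cfc g A = cfc (fun x => f x + g x) A :=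
  (cfc_add A f g (A.continuousOn_spectrum f) (A.continuousOn_spectrum g)).symm

theorem Matrix.cfc_sub_eq (A : Matrix n n ℂ) (f g : ℝ → ℝ) :
    cfc f A - cfc g A = cfc (fun x => f x - g x) A :=
  (cfc_sub f g A (A.continuousOn_spectrum f) (A.continuousOn_spectrum g)).symm

theorem Matrix.IsHermitian.cfc_id_eq (hA : A.IsHermitian) : cfc (fun x : ℝ => x) A = A :=
  cfc_id' ℝ A hA

theorem Matrix.IsHermitian.cfc_one_eq (hA : A.IsHermitian) : cfc (fun _ : ℝ => 1) A = 1 :=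
  cfc_const_one ℝ A hA

theorem Matrix.cfc_smul_eq (A : Matrix n n ℂ) (c : ℝ) (f : ℝ → ℝ) :
    (c : ℂ) • cfc f A = cfc (fun x => c * f x) A := by
  have := cfc_const_mul c f A (A.continuousOn_spectrum f)
  rw [this]
  exact Complex.coe_smul c _

theorem Matrix.IsHermitian.exp_smul_eq_cfc (hA : A.IsHermitian) (t : ℝ) :
    NormedSpace.exp ((t : ℂ) • A) = cfc (fun x : ℝ => Real.exp (t * x)) A := by
  have hsa : IsSelfAdjoint A := hA
  have h1 : (t : ℂ) • A = t • A := Complex.coe_smul t _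
  rw [h1, ← CFC.real_exp_eq_normedSpace_exp (IsSelfAdjoint.smul (.all t) hsa)]
  rw [cfc_comp_const_mul t Real.exp A]

theorem Matrix.cfc_exp_mul_cfc_exp (A : Matrix n n ℂ) (s t : ℝ) :
    cfc (fun x : ℝ => Real.exp (s * x)) A * cfc (fun x : ℝ => Real.exp (t * x)) A =
      cfc (fun x : ℝ => Real.exp ((s + t) * x)) A := by
  simp only [Matrix.cfc_mul_eq, ← Real.exp_add, add_mul]

theorem Matrix.IsHermitian.toEuclideanCLM_cfc_eigenvectorBasis (hA : A.IsHermitian) (f : ℝ → ℝ)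
    (i : n) : Matrix.toEuclideanCLM (𝕜 := ℂ) (cfc f A) (hA.eigenvectorBasis i) =
      (f (hA.eigenvalues i) : ℂ) • hA.eigenvectorBasis i := by
  have h1 : cfc f A = (hA.eigenvectorUnitary : Matrix n n ℂ) *
      Matrix.diagonal (RCLike.ofReal ∘ f ∘ hA.eigenvalues) *
      star (hA.eigenvectorUnitary : Matrix n n ℂ) := hA.cfc_eq f
  apply WithLp.ofLp_injective
  rw [Matrix.ofLp_toEuclideanCLM, h1, ← Matrix.mulVec_mulVec, ← Matrix.mulVec_mulVec]
  have h2 := hA.star_eigenvectorUnitary_mulVec i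
  have h3 := hA.eigenvectorUnitary_mulVec i
  rw [h2, Matrix.diagonal_mulVec_single, WithLp.ofLp_smul, ← h3, ← Matrix.mulVec_smul]
  congr 1
  ext j
  simp [Pi.single_apply]

theorem Matrix.IsHermitian.energy_cfc (hA : A.IsHermitian) (f : ℝ → ℝ)
    (ψ : EuclideanSpace ℂ n) :
    energy (cfc f A) ψ = ∑ i, f (hA.eigenvalues i) * ‖inner ℂ (hA.eigenvectorBasis i) ψ‖ ^ 2 :=
  energy_eq_sum _ (hA.toEuclideanCLM_cfc_eigenvectorBasis f) ψ

theorem Matrix.IsHermitian.le_energy_cfc (hA : A.IsHermitian) {f : ℝ → ℝ} {c : ℝ}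
    (h : ∀ x ∈ spectrum ℝ A, c ≤ f x) (ψ : EuclideanSpace ℂ n) :
    c * ‖ψ‖ ^ 2 ≤ energy (cfc f A) ψ := by
  rw [hA.energy_cfc, ← hA.eigenvectorBasis.sum_sq_norm_inner_right ψ, Finset.mul_sum]
  refine Finset.sum_le_sum fun i _ => ?_
  gcongr
  exact h _ (hA.eigenvalues_mem_spectrum_real i)

theorem Matrix.IsHermitian.energy_cfc_le (hA : A.IsHermitian) {f : ℝ → ℝ} {c : ℝ}
    (h : ∀ x ∈ spectrum ℝ A, f x ≤ c) (ψ : EuclideanSpace ℂ n) :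
    energy (cfc f A) ψ ≤ c * ‖ψ‖ ^ 2 := by
  rw [hA.energy_cfc, ← hA.eigenvectorBasis.sum_sq_norm_inner_right ψ, Finset.mul_sum]
  refine Finset.sum_le_sum fun i _ => ?_
  gcongr
  exact h _ (hA.eigenvalues_mem_spectrum_real i)

end FunctionalCalculus

/-! ### Sylvester equations with separated spectra -/

section Sylvester

variable {n : Type*} [Fintype n] [DecidableEq n]

/-- A solution `X` of the Sylvester equation `S X - X K = Y`, where the spectrum of `S` lies above
`α` and the one of `K` below `κ`, has norm at most `‖Y‖ / (α - κ)`. -/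
theorem norm_le_of_sylvester [Nonempty n] {S K X Y : Matrix n n ℂ} {α κ : ℝ}
    (hS : ∀ ψ, α * ‖ψ‖ ^ 2 ≤ energy S ψ) (hK : ∀ ψ, energy K ψ ≤ κ * ‖ψ‖ ^ 2)
    (h : S * X - X * K = Y) : (α - κ) * ‖X‖ ≤ ‖Y‖ := by
  obtain hX | hX := eq_or_ne ‖X‖ 0
  · rw [hX, mul_zero]; exact norm_nonneg _
  have hXX : (X.conjTranspose * X).IsHermitian := Matrix.isHermitian_conjTranspose_mul_self X
  have hsa : IsSelfAdjoint (X.conjTranspose * X) := hXX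
  -- A top right singular vector of X. Pairing the equation with Xψ turns the term XK into ‖X‖² ⟨ψ,
  -- Kψ⟩, so both form bounds apply directly.
  obtain ⟨ψ, hψ, hψX⟩ : ∃ ψ : EuclideanSpace ℂ n, ‖ψ‖ = 1 ∧
      Matrix.toEuclideanCLM (𝕜 := ℂ) (X.conjTranspose * X) ψ = ((‖X‖ ^ 2 : ℝ) : ℂ) • ψ := by
    have h1 : ‖X‖ ^ 2 ∈ spectrum ℝ (X.conjTranspose * X) := by
      have h2 : ‖X.conjTranspose * X‖ = ‖X‖ ^ 2 := by
        rw [Matrix.l2_opNorm_conjTranspose_mul_self, sq]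
      rcases CStarAlgebra.norm_or_neg_norm_mem_spectrum hsa with h3 | h3
      · rwa [h2] at h3
      · have h4 : (0 : ℂ) ≤ ((-‖X.conjTranspose * X‖ : ℝ) : ℂ) :=
          (Matrix.posSemidef_iff_isHermitian_and_spectrum_nonneg.mp
            (Matrix.posSemidef_conjTranspose_mul_self X)).2 h3
        rw [Complex.zero_le_real, h2] at h4
        have : 0 < ‖X‖ ^ 2 := by positivity
        linarith
    rw [hXX.spectrum_real_eq_range_eigenvalues] at h1
    obtain ⟨i, hi⟩ := h1
    refine ⟨hXX.eigenvectorBasis i, hXX.eigenvectorBasis.orthonormal.1 i, ?_⟩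
    have := hXX.toEuclideanCLM_cfc_eigenvectorBasis (fun x => x) i
    rwa [hXX.cfc_id_eq, hi] at this
  set T : Matrix n n ℂ → (EuclideanSpace ℂ n →L[ℂ] EuclideanSpace ℂ n) :=
    fun M => Matrix.toEuclideanCLM (𝕜 := ℂ) M with hT
  have hmul : ∀ (M N : Matrix n n ℂ) φ, T (M * N) φ = T M (T N φ) := fun M N φ => by
    simp [hT]
  have hadj : ∀ φ, inner ℂ (T X ψ) (T X φ) = ((‖X‖ ^ 2 : ℝ) : ℂ) * inner ℂ ψ φ := by
    intro φ
    have h1 : T X.conjTranspose = ContinuousLinearMap.adjoint (T X) :=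
      map_star (Matrix.toEuclideanCLM (𝕜 := ℂ) (n := n)) X
    rw [← ContinuousLinearMap.adjoint_inner_left, ← h1, ← hmul, show T _ ψ = _ from hψX,
      inner_smul_left, Complex.conj_ofReal]
  have hnorm : ‖T X ψ‖ ^ 2 = ‖X‖ ^ 2 := by
    have := hadj ψ
    rw [inner_self_eq_norm_sq_to_K, inner_self_eq_norm_sq_to_K, hψ] at this
    have h2 : ((‖T X ψ‖ ^ 2 : ℝ) : ℂ) = ((‖X‖ ^ 2 : ℝ) : ℂ) := by
      simpa using this
    exact_mod_cast h2
  have e1 : α * ‖X‖ ^ 2 ≤ (inner ℂ (T X ψ) (T (S * X) ψ)).re := by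
    rw [hmul, ← hnorm]; exact hS _
  have e2 : (inner ℂ (T X ψ) (T (X * K) ψ)).re ≤ κ * ‖X‖ ^ 2 := by
    rw [hmul, hadj, Complex.re_ofReal_mul]
    have := hK ψ
    rw [hψ, one_pow, mul_one] at this
    rw [mul_comm κ]
    gcongr
    exact this
  have e3 : (inner ℂ (T X ψ) (T Y ψ)).re ≤ ‖X‖ * ‖Y‖ := by
    refine (Complex.re_le_norm _).trans ((norm_inner_le_norm _ _).trans ?_)
    have h1 := norm_toEuclideanCLM_apply_le X ψ
    have h2 := norm_toEuclideanCLM_apply_le Y ψ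
    rw [hψ, mul_one] at h1 h2
    gcongr
  have e4 : T Y ψ = T (S * X) ψ - T (X * K) ψ := by rw [← h]; simp [hT]
  rw [e4, inner_sub_right, Complex.sub_re] at e3
  have hX' : 0 < ‖X‖ := lt_of_le_of_ne (norm_nonneg _) hX.symm
  refine le_of_mul_le_mul_left ?_ hX'
  nlinarith

end Sylvester

/-! ### Ordered eigenvalues and the min-max principle -/

section EnergyLevels

variable {n : Type*} [Fintype n] [DecidableEq n] {A : Matrix n n ℂ}

/-- The orthonormal eigenbasis of a Hermitian matrix, by increasing energy. -/
def levelBasis (hA : A.IsHermitian) :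
    OrthonormalBasis (Fin (Fintype.card n)) ℂ (EuclideanSpace ℂ n) :=
  hA.eigenvectorBasis.reindex
    ((Fintype.equivOfCardEq (Fintype.card_fin _)).symm.trans Fin.revPerm)

theorem energyLevel_mono (hA : A.IsHermitian) : Monotone (energyLevel hA) :=
  fun _ _ hij => hA.eigenvalues₀_antitone (Fin.rev_le_rev.mpr hij)

theorem eigenvalues_eq_energyLevel (hA : A.IsHermitian) (j : Fin (Fintype.card n)) :
    hA.eigenvalues (((Fintype.equivOfCardEq (Fintype.card_fin _)).symm.trans
      Fin.revPerm).symm j) = energyLevel hA j := by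
  simp [Matrix.IsHermitian.eigenvalues, energyLevel]

theorem toEuclideanCLM_cfc_levelBasis (hA : A.IsHermitian) (f : ℝ → ℝ)
    (j : Fin (Fintype.card n)) :
    Matrix.toEuclideanCLM (𝕜 := ℂ) (cfc f A) (levelBasis hA j) =
      (f (energyLevel hA j) : ℂ) • levelBasis hA j := by
  rw [levelBasis, OrthonormalBasis.reindex_apply, hA.toEuclideanCLM_cfc_eigenvectorBasis,
    eigenvalues_eq_energyLevel]

theorem toEuclideanCLM_levelBasis (hA : A.IsHermitian) (j : Fin (Fintype.card n)) :
    Matrix.toEuclideanCLM (𝕜 := ℂ) A (levelBasis hA j) =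
      (energyLevel hA j : ℂ) • levelBasis hA j := by
  have := toEuclideanCLM_cfc_levelBasis hA (fun x => x) j
  rwa [hA.cfc_id_eq] at this

theorem energy_eq_sum_levels (hA : A.IsHermitian) (ψ : EuclideanSpace ℂ n) :
    energy A ψ = ∑ j, energyLevel hA j * ‖inner ℂ (levelBasis hA j) ψ‖ ^ 2 :=
  energy_eq_sum _ (toEuclideanCLM_levelBasis hA) ψ

theorem groundEnergy_le_of_mem_spectrum [Nonempty n] (hA : A.IsHermitian) {x : ℝ}
    (hx : x ∈ spectrum ℝ A) : groundEnergy hA ≤ x := by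
  rw [hA.spectrum_real_eq_range_eigenvalues] at hx
  obtain ⟨i, rfl⟩ := hx
  obtain ⟨j, rfl⟩ := ((Fintype.equivOfCardEq (Fintype.card_fin _)).symm.trans
    Fin.revPerm).symm.surjective i
  rw [eigenvalues_eq_energyLevel]
  exact energyLevel_mono hA (Fin.mk_le_of_le_val (Nat.zero_le _))

theorem groundEnergy_mul_le_energy [Nonempty n] (hA : A.IsHermitian) (ψ : EuclideanSpace ℂ n) :
    groundEnergy hA * ‖ψ‖ ^ 2 ≤ energy A ψ := by
  have := hA.le_energy_cfc (f := fun x => x)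
    (fun x hx => groundEnergy_le_of_mem_spectrum hA hx) ψ
  rwa [hA.cfc_id_eq] at this

/-- **Courant–Fischer**, upper bound: if the energy of `A` is at most `c` on the span of the lowest
`j + 1` vectors of an orthonormal basis, then so is the `j`-th level of `A`. -/
theorem energyLevel_le (hA : A.IsHermitian)
    (u : OrthonormalBasis (Fin (Fintype.card n)) ℂ (EuclideanSpace ℂ n))
    (j : Fin (Fintype.card n)) {c : ℝ}
    (h : ∀ ψ : EuclideanSpace ℂ n, (∀ i, j < i → inner ℂ (u i) ψ = 0) →
      energy A ψ ≤ c * ‖ψ‖ ^ 2) : energyLevel hA j ≤ c := by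
  -- Orthogonality to the eigenvectors of A below j and to the `u i` above j amounts to one
  -- condition fewer than the dimension, so a nonzero ψ satisfies them all.
  set F : EuclideanSpace ℂ n →ₗ[ℂ] ({i : Fin (Fintype.card n) // i ≠ j} → ℂ) :=
    LinearMap.pi fun i => if i.1 < j then (innerSL ℂ (levelBasis hA i)).toLinearMap
      else (innerSL ℂ (u i)).toLinearMap with hF
  have hker : LinearMap.ker F ≠ ⊥ := by
    apply LinearMap.ker_ne_bot_of_finrank_lt
    rw [Module.finrank_fintype_fun_eq_card, finrank_euclideanSpace,
      Fintype.card_subtype_compl, Fintype.card_subtype_eq, Fintype.card_fin]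
    exact Nat.sub_lt (Fin.pos j) one_pos
  obtain ⟨ψ, hψ, hψ0⟩ := (Submodule.ne_bot_iff _).mp hker
  have hψ' : ∀ i (hi : i ≠ j), F ψ ⟨i, hi⟩ = 0 := fun i hi =>
    congrFun (LinearMap.mem_ker.mp hψ) ⟨i, hi⟩
  have h1 := h ψ fun i hi => by
    simpa [hF, hi.not_gt] using hψ' i hi.ne'
  have h2 : energyLevel hA j * ‖ψ‖ ^ 2 ≤ energy A ψ := by
    rw [energy_eq_sum_levels hA, ← (levelBasis hA).sum_sq_norm_inner_right ψ, Finset.mul_sum]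
    refine Finset.sum_le_sum fun i _ => ?_
    rcases lt_or_ge i j with hi | hi
    · have : inner ℂ (levelBasis hA i) ψ = 0 := by
        simpa [hF, hi] using hψ' i hi.ne
      simp [this]
    · gcongr
      exact energyLevel_mono hA hi
  have : 0 < ‖ψ‖ ^ 2 := by positivity
  exact le_of_mul_le_mul_right (h2.trans h1) this

theorem energy_le_of_inner_levelBasis_eq_zero (hA : A.IsHermitian) {j : Fin (Fintype.card n)}
    {ψ : EuclideanSpace ℂ n} (hψ : ∀ i, j < i → inner ℂ (levelBasis hA i) ψ = 0) :
    energy A ψ ≤ energyLevel hA j * ‖ψ‖ ^ 2 := by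
  rw [energy_eq_sum_levels hA, ← (levelBasis hA).sum_sq_norm_inner_right ψ, Finset.mul_sum]
  refine Finset.sum_le_sum fun i _ => ?_
  rcases lt_or_ge j i with hi | hi
  · simp [hψ i hi]
  · gcongr
    exact energyLevel_mono hA hi

theorem energyLevel_le_energyLevel {A' : Matrix n n ℂ} (hA : A.IsHermitian)
    (hA' : A'.IsHermitian) (h : ∀ ψ, energy A ψ ≤ energy A' ψ) (j : Fin (Fintype.card n)) :
    energyLevel hA j ≤ energyLevel hA' j :=
  energyLevel_le hA (levelBasis hA') j fun ψ hψ =>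
    (h ψ).trans (energy_le_of_inner_levelBasis_eq_zero hA' hψ)

theorem toEuclideanCLM_spectralProj_of_inner_eq_zero (hA : A.IsHermitian)
    {j : Fin (Fintype.card n)} {I : Set ℝ} (hI : ∀ i ≤ j, energyLevel hA i ∈ I)
    {ψ : EuclideanSpace ℂ n} (hψ : ∀ i, j < i → inner ℂ (levelBasis hA i) ψ = 0) :
    Matrix.toEuclideanCLM (𝕜 := ℂ) (spectralProj A I) ψ = ψ := by
  conv_lhs => rw [← (levelBasis hA).sum_repr' ψ]
  conv_rhs => rw [← (levelBasis hA).sum_repr' ψ]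
  rw [map_sum]
  refine Finset.sum_congr rfl fun i _ => ?_
  rcases lt_or_ge j i with hi | hi
  · simp [hψ i hi]
  · rw [map_smul, spectralProj, toEuclideanCLM_cfc_levelBasis, Set.indicator_of_mem (hI i hi)]
    simp

/-- If `A'` differs little from `A` on the low-energy states of `A'`, then the low levels of `A`
are not much higher than those of `A'`. -/
theorem energyLevel_le_add_norm {A' : Matrix n n ℂ} (hA : A.IsHermitian)
    (hA' : A'.IsHermitian) (j : Fin (Fintype.card n)) {I : Set ℝ}
    (hI : ∀ i ≤ j, energyLevel hA' i ∈ I) :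
    energyLevel hA j ≤ energyLevel hA' j + ‖(A - A') * spectralProj A' I‖ := by
  refine energyLevel_le hA (levelBasis hA') j fun ψ hψ => ?_
  have h1 : energy (A - A') ψ = energy ((A - A') * spectralProj A' I) ψ := by
    rw [energy, energy, map_mul, mul_apply_eq_comp,
      toEuclideanCLM_spectralProj_of_inner_eq_zero hA' hI hψ]
  have h2 := energy_le_of_inner_levelBasis_eq_zero hA' hψ
  have h3 := energy_le_norm ((A - A') * spectralProj A' I) ψ
  rw [← h1, energy_sub] at h3
  linarith

end EnergyLevels

/-! ### Exponential decay above the cutoff, abstractly for A + B + C -/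

section Truncation

variable {n : Type*} [Fintype n] [DecidableEq n] {A B C : Matrix n n ℂ}

theorem Matrix.norm_cfc_le (A : Matrix n n ℂ) {f : ℝ → ℝ} {c : ℝ} (hc : 0 ≤ c)
    (h : ∀ x ∈ spectrum ℝ A, |f x| ≤ c) : ‖cfc f A‖ ≤ c :=
  _root_.norm_cfc_le hc h

theorem Matrix.IsHermitian.cfc_min_eq (hA : A.IsHermitian) (h0 : ∀ x ∈ spectrum ℝ A, 0 ≤ x)
    (τ : ℝ) : A * spectralProj A (Set.Ico 0 τ) + (τ : ℂ) • spectralProj A (Set.Ici τ) =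
      cfc (fun x => min x τ) A := by
  have h1 : A * spectralProj A (Set.Ico 0 τ) =
      cfc (fun x : ℝ => x) A * cfc ((Set.Ico 0 τ).indicator fun _ => (1 : ℝ)) A := by
    rw [hA.cfc_id_eq]; rfl
  rw [h1, spectralProj, Matrix.cfc_mul_eq, Matrix.cfc_smul_eq, Matrix.cfc_add_eq]
  refine cfc_congr fun x hx => ?_
  have := h0 x hx
  rcases lt_or_ge x τ with h | h
  · simp [Set.indicator, this, h, h.le]
  · simp [Set.indicator, h]

/-- The part of `A` above the cutoff `τ` is exponentially dominated. -/
theorem norm_sub_cfc_min_mul_le (hA : A.IsHermitian) {lam : ℝ} (hlam : 0 < lam) (τ : ℝ)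
    (P : Matrix n n ℂ) : ‖(A - cfc (fun x => min x τ) A) * P‖ ≤
      1 / lam * Real.exp (-lam * τ) * ‖cfc (fun x : ℝ => Real.exp (lam * x)) A * P‖ := by
  have h1 : A - cfc (fun x => min x τ) A =
      cfc (fun x => (x - min x τ) * Real.exp (-lam * x)) A *
        cfc (fun x : ℝ => Real.exp (lam * x)) A := by
    nth_rw 1 [← hA.cfc_id_eq]
    rw [Matrix.cfc_sub_eq, Matrix.cfc_mul_eq]
    congr 1
    ext x
    rw [mul_assoc, ← Real.exp_add]
    simp
  rw [h1, mul_assoc]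
  refine (norm_mul_le _ _).trans ?_
  gcongr
  refine Matrix.norm_cfc_le _ (by positivity) fun x _ => ?_
  have h2 : 0 ≤ x - min x τ := sub_nonneg.mpr (min_le_left _ _)
  rw [abs_of_nonneg (by positivity)]
  have h3 : x - min x τ ≤ 1 / lam * Real.exp (lam * (x - τ)) := by
    rw [one_div, ← div_eq_inv_mul, le_div_iff₀ hlam]
    rcases le_total x τ with h | h
    · rw [min_eq_left h, sub_self, zero_mul]; positivity
    · rw [min_eq_right h]
      linarith [Real.add_one_le_exp (lam * (x - τ))]
  calc (x - min x τ) * Real.exp (-lam * x)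
      ≤ 1 / lam * Real.exp (lam * (x - τ)) * Real.exp (-lam * x) := by gcongr
    _ = _ := by
      rw [mul_assoc, ← Real.exp_add]
      ring_nf

/-- With H = C + A + B, the operator factors as e^{-λC} · (e^{λ(C+A)} e^{-λH}) · (e^{λH} P). The
outer factors are bounded on spectra, the middle one by the interaction picture. -/
theorem norm_exp_mul_spectralProj_le [Nonempty n] (hA : A.IsHermitian) (hB : B.IsHermitian)
    (hC : C.IsHermitian) (hAC : Commute A C) {lam b ε γ : ℝ} (hlam : 0 ≤ lam)
    (hγ : ∀ x ∈ spectrum ℝ C, γ ≤ x)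
    (hb : ∀ t : ℝ, 0 ≤ t → t ≤ lam → ‖NormedSpace.exp ((t : ℂ) • (C + A)) * B *
      NormedSpace.exp (-((t : ℂ) • (C + A)))‖ ≤ 2 * b) :
    ‖cfc (fun x : ℝ => Real.exp (lam * x)) A * spectralProj (C + A + B) (Set.Icc 0 ε)‖ ≤
      Real.exp (lam * (ε - γ + 2 * b)) := by
  have hH : (C + A + B).IsHermitian := (hC.add hA).add hB
  have h1 : cfc (fun x : ℝ => Real.exp (lam * x)) A =
      cfc (fun x : ℝ => Real.exp (-lam * x)) C * NormedSpace.exp ((lam : ℂ) • (C + A)) := by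
    rw [← hA.exp_smul_eq_cfc, ← hC.exp_smul_eq_cfc, smul_add,
      exp_add_of_commute_complex ((hAC.symm.smul_left _).smul_right _), ← mul_assoc,
      Complex.ofReal_neg, neg_smul, exp_neg_mul_exp, one_mul]
  have h2 : spectralProj (C + A + B) (Set.Icc 0 ε) =
      NormedSpace.exp (-((lam : ℂ) • (C + A + B))) *
        cfc (fun x : ℝ => Real.exp (lam * x) * (Set.Icc 0 ε).indicator (fun _ => (1 : ℝ)) x)
          (C + A + B) := by
    rw [← neg_smul, ← Complex.ofReal_neg, hH.exp_smul_eq_cfc, Matrix.cfc_mul_eq, spectralProj]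
    congr 1
    ext x
    rw [← mul_assoc, ← Real.exp_add]
    simp
  have h3 : ‖cfc (fun x : ℝ => Real.exp (-lam * x)) C‖ ≤ Real.exp (-lam * γ) := by
    refine Matrix.norm_cfc_le _ (Real.exp_pos _).le fun x hx => ?_
    rw [abs_of_pos (Real.exp_pos _), Real.exp_le_exp]
    nlinarith [hγ x hx]
  have h4 : ‖cfc (fun x : ℝ => Real.exp (lam * x) *
      (Set.Icc 0 ε).indicator (fun _ => (1 : ℝ)) x) (C + A + B)‖ ≤ Real.exp (lam * ε) := by
    refine Matrix.norm_cfc_le _ (Real.exp_pos _).le fun x _ => ?_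
    by_cases hx : x ∈ Set.Icc 0 ε
    · rw [Set.indicator_of_mem hx, mul_one, abs_of_pos (Real.exp_pos _), Real.exp_le_exp]
      exact mul_le_mul_of_nonneg_left hx.2 hlam
    · rw [Set.indicator_of_notMem hx, mul_zero, abs_zero]
      positivity
  have h5 := norm_exp_mul_exp_neg_add_le hlam hb
  rw [h1, h2]
  calc _ = ‖cfc (fun x : ℝ => Real.exp (-lam * x)) C * (NormedSpace.exp ((lam : ℂ) • (C + A)) *
        NormedSpace.exp (-((lam : ℂ) • (C + A + B)))) *
        cfc (fun x : ℝ => Real.exp (lam * x) * (Set.Icc 0 ε).indicator (fun _ => (1 : ℝ)) x)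
          (C + A + B)‖ := by simp only [mul_assoc]
    _ ≤ Real.exp (-lam * γ) * Real.exp (2 * b * lam) * Real.exp (lam * ε) := by
        refine (norm_mul_le _ _).trans ?_
        gcongr
        refine (norm_mul_le _ _).trans ?_
        gcongr
    _ = _ := by
        rw [← Real.exp_add, ← Real.exp_add]
        ring_nf

/-- Energies of `A` above `a` are classically forbidden at energies up to `ε` in the truncated
system. -/
theorem norm_exp_mul_spectralProj_truncated_le [Nonempty n] (hA : A.IsHermitian)
    (hB : B.IsHermitian) (hC : C.IsHermitian) (hAC : Commute A C) {lam b ε γ δ τ : ℝ}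
    (hlam : 0 ≤ lam) (hb0 : 0 ≤ b) (hδ : 0 < δ) (hγ : ∀ x ∈ spectrum ℝ C, γ ≤ x)
    (hb : ‖NormedSpace.exp ((lam : ℂ) • A) * B * NormedSpace.exp (-((lam : ℂ) • A))‖ ≤ 2 * b)
    (hτ : ε - γ + 4 * b + δ ≤ τ) :
    ‖cfc (fun x : ℝ => Real.exp (lam * x)) A *
      spectralProj (cfc (fun x => min x τ) A + B + C) (Set.Icc 0 ε)‖ ≤
      2 * Real.exp (lam * (ε - γ + 4 * b + δ)) := by
  set a := ε - γ + 4 * b + δ with ha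
  set K := cfc (fun x => min x τ) A + B + C with hK
  have hKh : K.IsHermitian := ((show IsSelfAdjoint (cfc (fun x => min x τ) A) from
    cfc_predicate _ _).add hB).add hC
  set P := spectralProj K (Set.Icc 0 ε) with hP
  -- For ε ≥ 0 the compression `KP`, which vanishes off the window, still satisfies `KP` ≤ ε; for ε
  -- < 0 the window is empty.
  rcases lt_or_ge ε 0 with hε | hε
  · have : P = 0 := by
      rw [hP, Set.Icc_eq_empty (not_le.mpr hε), spectralProj, Set.indicator_empty]
      exact cfc_const_zero ℝ K
    rw [this, mul_zero, norm_zero]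
    positivity
  have hcomm : ∀ f : ℝ → ℝ, cfc f A * C = C * cfc f A := fun f => (hAC.cfc_real f).eq
  set KP := cfc (fun x => x * (Set.Icc 0 ε).indicator (fun _ => (1 : ℝ)) x) K with hKPdef
  have hPK : P * KP = K * P := by
    have h1 : K * P = cfc (fun x : ℝ => x) K * cfc ((Set.Icc 0 ε).indicator fun _ => (1 : ℝ)) K := by
      rw [hKh.cfc_id_eq]; rfl
    rw [h1, hP, spectralProj, Matrix.cfc_mul_eq, Matrix.cfc_mul_eq]
    congr 1
    ext x
    by_cases hx : x ∈ Set.Icc 0 ε <;> simp [hx]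
  set W := cfc (fun x : ℝ => Real.exp (lam * x)) A with hW
  set W' := cfc (fun x : ℝ => Real.exp (-lam * x)) A with hW'
  have hWW : W' * W = 1 := by
    rw [hW, hW', Matrix.cfc_exp_mul_cfc_exp, neg_add_cancel]
    simpa using hA.cfc_one_eq
  have hWB : ‖W * B * W'‖ ≤ 2 * b := by
    rwa [hW, hW', ← hA.exp_smul_eq_cfc, ← hA.exp_smul_eq_cfc, Complex.ofReal_neg, neg_smul]
  set Q := cfc ((Set.Ici a).indicator fun _ => (1 : ℝ)) A with hQ
  set R := cfc ((Set.Iio a).indicator fun _ => (1 : ℝ)) A with hR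
  have hQR : Q + R = 1 := by
    rw [hQ, hR, Matrix.cfc_add_eq, ← hA.cfc_one_eq]
    congr 1
    ext x
    rcases lt_or_ge x a with h | h
    · simp [Set.indicator, h, h.not_ge]
    · simp [Set.indicator, h, h.not_gt]
  have hQ1 : ‖Q‖ ≤ 1 := by
    refine Matrix.norm_cfc_le _ zero_le_one fun x _ => ?_
    by_cases hx : x ∈ Set.Ici a
    · rw [Set.indicator_of_mem hx, abs_one]
    · rw [Set.indicator_of_notMem hx, abs_zero]; exact zero_le_one
  have hP1 : ‖P‖ ≤ 1 := by
    refine Matrix.norm_cfc_le _ zero_le_one fun x _ => ?_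
    by_cases hx : x ∈ Set.Icc 0 ε
    · rw [Set.indicator_of_mem hx, abs_one]
    · rw [Set.indicator_of_notMem hx, abs_zero]; exact zero_le_one
  have hRW : ‖R * W‖ ≤ Real.exp (lam * a) := by
    rw [hR, hW, Matrix.cfc_mul_eq]
    refine Matrix.norm_cfc_le _ (Real.exp_pos _).le fun x _ => ?_
    by_cases hx : x ∈ Set.Iio a
    · rw [Set.indicator_of_mem hx, one_mul, abs_of_pos (Real.exp_pos _), Real.exp_le_exp]
      exact mul_le_mul_of_nonneg_left (le_of_lt hx) hlam
    · rw [Set.indicator_of_notMem hx, zero_mul, abs_zero]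
      positivity
  have hWP : ‖W * P‖ ≤ ‖Q * W * P‖ + Real.exp (lam * a) := by
    calc ‖W * P‖ = ‖Q * W * P + R * W * P‖ := by rw [← add_mul, ← add_mul, hQR, one_mul]
      _ ≤ ‖Q * W * P‖ + ‖R * W‖ * ‖P‖ := (norm_add_le _ _).trans (by gcongr; exact norm_mul_le _ _)
      _ ≤ ‖Q * W * P‖ + Real.exp (lam * a) * 1 := by gcongr
      _ = _ := by rw [mul_one]
  -- Since a ≤ τ, this agrees with min(A, τ) + C on the range of Q, but it is bounded below by a + γ
  -- on the whole space, as the Sylvester bound requires.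
  set S := cfc (fun x => max (min x τ) a) A + C with hS
  have hSX : S * (Q * W * P) - (Q * W * P) * KP = -(Q * (W * B * W') * (W * P)) := by
    have e1 : cfc (fun x => max (min x τ) a) A * (Q * W) =
        Q * W * cfc (fun x => min x τ) A := by
      rw [hQ, hW, Matrix.cfc_mul_eq, Matrix.cfc_mul_eq, Matrix.cfc_mul_eq]
      congr 1
      ext x
      by_cases hx : x ∈ Set.Ici a
      · rw [max_eq_left (le_min hx hτ), mul_comm]
      · simp [hx]
    have e2 : C * (Q * W) = Q * W * C := by
      rw [hQ, hW, Matrix.cfc_mul_eq, hcomm]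
    have e3 : S * (Q * W * P) = Q * W * cfc (fun x => min x τ) A * P + Q * W * C * P := by
      rw [hS, add_mul, ← mul_assoc _ (Q * W) P, ← mul_assoc C (Q * W) P, e1, e2]
    have e4 : Q * W * P * KP = Q * W * (K * P) := by rw [← hPK]; simp only [mul_assoc]
    have e5 : Q * (W * B * W') * (W * P) = Q * W * B * P := by
      calc _ = Q * W * B * (W' * W) * P := by simp only [mul_assoc]
        _ = _ := by rw [hWW, mul_one]
    rw [e3, e4, e5, hK]
    noncomm_ring
  have hSge : ∀ ψ, (a + γ) * ‖ψ‖ ^ 2 ≤ energy S ψ := by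
    intro ψ
    have h1 := hA.le_energy_cfc (f := fun x => max (min x τ) a) (fun x _ => le_max_right _ _) ψ
    have h2 := hC.le_energy_cfc (f := fun x => x) hγ ψ
    rw [hC.cfc_id_eq] at h2
    rw [hS, energy_add, add_mul]
    exact add_le_add h1 h2
  have hKPle : ∀ ψ, energy KP ψ ≤ ε * ‖ψ‖ ^ 2 := by
    refine hKh.energy_cfc_le fun x _ => ?_
    by_cases hx : x ∈ Set.Icc 0 ε
    · rw [Set.indicator_of_mem hx, mul_one]; exact hx.2
    · rw [Set.indicator_of_notMem hx, mul_zero]; exact hε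
  have hX := norm_le_of_sylvester hSge hKPle hSX
  have hY : ‖-(Q * (W * B * W') * (W * P))‖ ≤
      1 * (2 * b) * (‖Q * W * P‖ + Real.exp (lam * a)) := by
    rw [norm_neg]
    refine (norm_mul_le _ _).trans ?_
    gcongr
    exact (norm_mul_le _ _).trans (by gcongr)
  have hXle : ‖Q * W * P‖ ≤ Real.exp (lam * a) := by
    -- The bounds combine to (4b + δ)‖X‖ ≤ 2b(‖X‖ + e^{λa}) for X = QWP. Moving 2b‖X‖ to the left
    -- leaves (2b + δ)‖X‖ ≤ 2b e^{λa}; δ > 0 covers the case b = 0.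
    have h1 : (4 * b + δ) * ‖Q * W * P‖ ≤ (4 * b + δ) * Real.exp (lam * a) := by
      have h2 : a + γ - ε = 4 * b + δ := by rw [ha]; ring
      rw [h2] at hX
      nlinarith [mul_nonneg hb0 (norm_nonneg (Q * W * P)), Real.exp_pos (lam * a),
        mul_nonneg hδ.le (norm_nonneg (Q * W * P)), hX.trans hY]
    exact le_of_mul_le_mul_left h1 (by positivity)
  linarith

end Truncation

/-! ### Product states -/

section ProductState

variable {Λ : Type*} [Fintype Λ] [DecidableEq Λ] {d : ℕ}

/-- An operator acting only inside `L` acts only on the first factor of a product state. -/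
theorem SupportedOn.mulVec_product {X L : Finset Λ} (hXL : X ⊆ L) {M : Op Λ d}
    (hM : SupportedOn X M) (ψ χ : Config Λ d → ℂ) (c : Config Λ d)
    (hχ : ∀ σ σ' : Config Λ d, (∀ i, i ∉ L → σ i = σ' i) → χ σ = χ σ') (σ : Config Λ d) :
    (M.mulVec fun σ => ψ (L.piecewise σ c) * χ σ) σ =
      M.mulVec ψ (L.piecewise σ c) * χ σ := by
  obtain ⟨A, hA⟩ := hM
  simp only [Matrix.mulVec, dotProduct, Finset.sum_mul]
  have hne : ∀ {s s' : Config Λ d}, M s s' ≠ 0 → ∀ i, i ∉ X → s i = s' i := by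
    intro s s' h
    by_contra hc
    exact h (by rw [hA, if_neg hc])
  have hM : ∀ ρ : Config Λ d, (∀ i, i ∉ L → σ i = ρ i) →
      M (L.piecewise σ c) (L.piecewise ρ c) = M σ ρ := by
    intro ρ hρ
    have e1 : (∀ i, i ∉ X → L.piecewise σ c i = L.piecewise ρ c i) ↔
        ∀ i, i ∉ X → σ i = ρ i := by
      refine forall_congr' fun i => ?_
      by_cases hi : i ∈ L
      · simp [hi]
      · simp [hi, hρ i hi]
    have e2 : ∀ s : Config Λ d, (fun i : X => L.piecewise s c i) = fun i : X => s i := by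
      intro s
      funext i
      exact Finset.piecewise_eq_of_mem _ _ _ (hXL i.2)
    rw [hA, hA, e2, e2]
    simp only [e1]
  -- Nonzero terms have ρ equal to σ off X, hence off L, so overwriting ρ by c there loses nothing;
  -- overwriting by σ undoes it.
  refine Finset.sum_bij_ne_zero (fun ρ _ _ => L.piecewise ρ c) (fun _ _ _ => Finset.mem_univ _)
    ?_ ?_ ?_
  · intro ρ _ h1 ρ' _ h2 h
    have h1' := hne (left_ne_zero_of_mul h1)
    have h2' := hne (left_ne_zero_of_mul h2)
    funext i
    by_cases hi : i ∈ L
    · simpa [hi] using congrFun h i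
    · rw [← h1' i fun hx => hi (hXL hx), ← h2' i fun hx => hi (hXL hx)]
  · intro ρ _ h
    have h' := hne (left_ne_zero_of_mul (left_ne_zero_of_mul h))
    have e1 : L.piecewise (L.piecewise ρ σ) c = ρ := by
      funext i
      by_cases hi : i ∈ L
      · simp [hi]
      · simpa [hi] using h' i fun hx => hi (hXL hx)
    refine ⟨L.piecewise ρ σ, Finset.mem_univ _, ?_, e1⟩
    have e2 : ∀ i, i ∉ L → σ i = L.piecewise ρ σ i := fun i hi => by simp [hi]
    rwa [e1, ← hM _ e2, e1, ← hχ σ _ e2, ← mul_assoc]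
  · intro ρ _ h
    have h' := hne (left_ne_zero_of_mul h)
    have e2 : ∀ i, i ∉ L → σ i = ρ i := fun i hi => h' i fun hx => hi (hXL hx)
    rw [hM ρ e2, hχ σ ρ e2, mul_assoc]

end ProductState

/-! ### Ground energies and the truncated spin Hamiltonian -/

namespace SpinSystem

variable {Λ : Type*} [Fintype Λ] [DecidableEq Λ] {d k : ℕ} {g : ℝ}

theorem hamOut_isHermitian (S : SpinSystem Λ d k g) (L : Finset Λ) : (S.hamOut L).IsHermitian :=
  S.isHermitian_sum (outside L)

theorem hamBd_isHermitian (S : SpinSystem Λ d k g) (L : Finset Λ) : (S.hamBd L).IsHermitian :=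
  S.isHermitian_sum (boundary L)

theorem bdSize_nonneg (S : SpinSystem Λ d k g) (L : Finset Λ) : 0 ≤ S.bdSize L :=
  Finset.sum_nonneg fun _ _ => norm_nonneg _

theorem commute_hamIn_hamOut (S : SpinSystem Λ d k g) (L : Finset Λ) :
    Commute (S.hamIn L) (S.hamOut L) := by
  refine Commute.sum_left _ _ _ fun X hX => Commute.sum_right _ _ _ fun Z hZ => S.commute_h ?_
  have h1 : X ⊆ L := (Finset.mem_filter.mp hX).2
  have h2 : Z ⊆ Lᶜ := (Finset.mem_filter.mp hZ).2.2
  exact Finset.disjoint_of_subset_left h1 (Finset.disjoint_of_subset_right h2 disjoint_compl_right)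

theorem posSemidef_sum (S : SpinSystem Λ d k g) (E : Finset (Finset Λ)) :
    (∑ X ∈ E, S.h X).PosSemidef :=
  Matrix.posSemidef_sum _ fun X _ => S.posSemidef X

theorem sum_mulVec_product (S : SpinSystem Λ d k g) {E : Finset (Finset Λ)} {L : Finset Λ}
    (hE : ∀ X ∈ E, X ⊆ L) (ψ χ : Config Λ d → ℂ) (c : Config Λ d)
    (hχ : ∀ σ σ' : Config Λ d, (∀ i, i ∉ L → σ i = σ' i) → χ σ = χ σ') (σ : Config Λ d) :
    ((∑ X ∈ E, S.h X).mulVec fun σ => ψ (L.piecewise σ c) * χ σ) σ =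
      (∑ X ∈ E, S.h X).mulVec ψ (L.piecewise σ c) * χ σ := by
  rw [Matrix.sum_mulVec, Matrix.sum_mulVec, Finset.sum_apply, Finset.sum_apply, Finset.sum_mul]
  exact Finset.sum_congr rfl fun X hX =>
    (S.supportedOn X).mulVec_product (hE X hX) ψ χ c hχ σ

/-- A product of ground states of the two regions bounds the ground energy. -/
theorem groundEnergy_ham_le [NeZero d] (S : SpinSystem Λ d k g) (L : Finset Λ) :
    groundEnergy S.ham_isHermitian ≤ groundEnergy (S.hamIn_isHermitian L) +
      groundEnergy (S.hamOut_isHermitian L) + S.bdSize L := by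
  set e := groundEnergy (S.hamIn_isHermitian L) with he
  set e' := groundEnergy (S.hamOut_isHermitian L) with he'
  have hev : ∀ {A : Op Λ d} (hA : A.IsHermitian), ∃ ψ : Config Λ d → ℂ, (∃ s, ψ s ≠ 0) ∧
      A.mulVec ψ = (groundEnergy hA : ℂ) • ψ := by
    intro A hA
    refine ⟨WithLp.ofLp (levelBasis hA ⟨0, Fintype.card_pos⟩), ?_, ?_⟩
    · by_contra! h
      refine (levelBasis hA).orthonormal.ne_zero ⟨0, Fintype.card_pos⟩ ?_
      ext s
      exact h s
    · exact congrArg WithLp.ofLp (toEuclideanCLM_levelBasis hA ⟨0, Fintype.card_pos⟩)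
  obtain ⟨ψ, ⟨c, hc⟩, hψ⟩ := hev (S.hamIn_isHermitian L)
  obtain ⟨χ, ⟨c', hc'⟩, hχ⟩ := hev (S.hamOut_isHermitian L)
  -- Freezing the spins outside each region at c or c' extracts from the two ground states one
  -- factor on L and one on Lᶜ. As ψ c and χ c' are nonzero, φ does not vanish at `L.piecewise c
  -- c'`.
  set φ : Config Λ d → ℂ := fun σ => ψ (L.piecewise σ c) * χ (Lᶜ.piecewise σ c') with hφ
  have h1 : (S.hamIn L).mulVec φ = (e : ℂ) • φ := by
    funext σ
    have := S.sum_mulVec_product (E := inside L) (L := L)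
      (fun X hX => (Finset.mem_filter.mp hX).2) ψ (fun σ => χ (Lᶜ.piecewise σ c')) c
      (fun s s' h => congrArg χ (Finset.piecewise_congr _ (fun i hi => h i (Finset.mem_compl.mp hi))
        fun _ _ => rfl)) σ
    rw [show ∑ X ∈ inside L, S.h X = S.hamIn L from rfl, hψ] at this
    rw [hφ, this]
    simp [mul_assoc, he]
  have h2 : (S.hamOut L).mulVec φ = (e' : ℂ) • φ := by
    funext σ
    have := S.sum_mulVec_product (E := outside L) (L := Lᶜ)
      (fun X hX => (Finset.mem_filter.mp hX).2.2) χ (fun σ => ψ (L.piecewise σ c)) c'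
      (fun s s' h => congrArg ψ (Finset.piecewise_congr _
        (fun i hi => h i fun hi' => Finset.mem_compl.mp hi' hi) fun _ _ => rfl)) σ
    rw [show ∑ X ∈ outside L, S.h X = S.hamOut L from rfl, hχ] at this
    simp only [mul_comm (χ _)] at this
    rw [hφ, this]
    simp only [Pi.smul_apply, smul_eq_mul, he']
    ring
  set Φ : EuclideanSpace ℂ (Config Λ d) := WithLp.toLp 2 φ with hΦ
  have hΦ0 : Φ ≠ 0 := by
    intro h
    have h3 : φ (L.piecewise c c') = 0 := congrFun (congrArg WithLp.ofLp h) _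
    have e1 : L.piecewise (L.piecewise c c') c = c := by
      funext i; by_cases hi : i ∈ L <;> simp [hi]
    have e2 : Lᶜ.piecewise (L.piecewise c c') c' = c' := by
      funext i; by_cases hi : i ∈ L <;> simp [hi]
    rw [hφ] at h3
    simp only [e1, e2] at h3
    exact mul_ne_zero hc hc' h3
  have hen : ∀ {A : Op Λ d} {x : ℝ}, A.mulVec φ = (x : ℂ) • φ → energy A Φ = x * ‖Φ‖ ^ 2 := by
    intro A x h
    rw [energy, hΦ, Matrix.toEuclideanCLM_toLp, h, WithLp.toLp_smul, inner_smul_right,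
      inner_self_eq_norm_sq_to_K, Complex.re_ofReal_mul]
    norm_cast
  have h3 := groundEnergy_mul_le_energy S.ham_isHermitian Φ
  have h4 : energy S.ham Φ = e * ‖Φ‖ ^ 2 + energy (S.hamBd L) Φ + e' * ‖Φ‖ ^ 2 := by
    rw [S.ham_eq L, energy_add, energy_add, hen h1, hen h2]
  have h5 : energy (S.hamBd L) Φ ≤ S.bdSize L * ‖Φ‖ ^ 2 :=
    (energy_le_norm _ _).trans (by gcongr; exact S.norm_hamBd_le L)
  have h6 : 0 < ‖Φ‖ ^ 2 := by positivity
  refine le_of_mul_le_mul_right ?_ h6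
  linarith

theorem spectrum_nonneg (S : SpinSystem Λ d k g) (E : Finset (Finset Λ)) {x : ℝ}
    (hx : x ∈ spectrum ℝ (∑ X ∈ E, S.h X)) : 0 ≤ x := by
  have h : (0 : ℂ) ≤ (x : ℂ) :=
    (Matrix.posSemidef_iff_isHermitian_and_spectrum_nonneg.mp (S.posSemidef_sum E)).2 hx
  exact Complex.zero_le_real.mp h

theorem truncIn_eq (S : SpinSystem Λ d k g) (L : Finset Λ) (τ : ℝ) :
    S.truncIn L τ = cfc (fun x => min x τ) (S.hamIn L) :=
  (S.hamIn_isHermitian L).cfc_min_eq (fun _ => S.spectrum_nonneg (inside L)) τ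

theorem ham_sub_truncHam (S : SpinSystem Λ d k g) (L : Finset Λ) (τ : ℝ) :
    S.ham - S.truncHam L τ = S.hamIn L - cfc (fun x => min x τ) (S.hamIn L) := by
  rw [S.ham_eq L, truncHam, truncIn_eq]
  abel

theorem energy_truncHam_le (S : SpinSystem Λ d k g) (L : Finset Λ) (τ : ℝ)
    (ψ : EuclideanSpace ℂ (Config Λ d)) : energy (S.truncHam L τ) ψ ≤ energy S.ham ψ := by
  have h1 : energy (S.ham - S.truncHam L τ) ψ =
      energy (cfc (fun x => x - min x τ) (S.hamIn L)) ψ := by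
    rw [ham_sub_truncHam, ← Matrix.cfc_sub_eq, (S.hamIn_isHermitian L).cfc_id_eq]
  have h2 := (S.hamIn_isHermitian L).le_energy_cfc (f := fun x => x - min x τ) (c := 0)
    (fun x _ => sub_nonneg.mpr (min_le_left _ _)) ψ
  rw [energy_sub] at h1
  linarith

/-- Ensures that the window [0, μ] contains every level of the truncated Hamiltonian up to μ. -/
theorem energyLevel_truncHam_nonneg [NeZero d] (S : SpinSystem Λ d k g) (L : Finset Λ) {τ : ℝ}
    (hτ : 0 ≤ τ) (j : Fin (Fintype.card (Config Λ d))) :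
    0 ≤ energyLevel (S.truncHam_isHermitian L τ) j := by
  have hE : ∀ (E : Finset (Finset Λ)) (ψ : EuclideanSpace ℂ (Config Λ d)),
      0 * ‖ψ‖ ^ 2 ≤ energy (∑ X ∈ E, S.h X) ψ := by
    intro E ψ
    have := (S.isHermitian_sum E).le_energy_cfc (f := fun x => x)
      (fun _ => S.spectrum_nonneg E) ψ
    rwa [(S.isHermitian_sum E).cfc_id_eq] at this
  set φ := levelBasis (S.truncHam_isHermitian L τ) j with hφ
  have h1 : energy (S.truncHam L τ) φ = energyLevel (S.truncHam_isHermitian L τ) j := by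
    rw [energy, hφ, toEuclideanCLM_levelBasis, inner_smul_right, inner_self_eq_norm_sq_to_K,
      (levelBasis _).orthonormal.1]
    simp
  have h2 := (S.hamIn_isHermitian L).le_energy_cfc (f := fun x => min x τ) (c := 0)
    (fun x hx => le_min (S.spectrum_nonneg (inside L) hx) hτ) φ
  have h3 := hE (boundary L) φ
  have h4 := hE (outside L) φ
  rw [← h1, truncHam, truncIn_eq, energy_add, energy_add, hamBd, hamOut]
  linarith

end SpinSystem

/-! ### Norm bounds for the spin system -/

namespace SpinSystem

variable {Λ : Type*} [Fintype Λ] [DecidableEq Λ] {d k : ℕ} {g : ℝ}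

theorem norm_ham_sub_mul_spectralProj_ham_le [NeZero d] (S : SpinSystem Λ d k g) (hg : 0 ≤ g)
    {lam : ℝ} (hlam : 0 < lam) (hlamgk : lam * (g * k) ≤ 1 / 2) (L : Finset Λ) (τ ε : ℝ) :
    ‖(S.ham - S.truncHam L τ) * spectralProj S.ham (Set.Icc 0 ε)‖ ≤
      1 / lam * Real.exp (-lam * (τ - groundEnergy (S.hamIn_isHermitian L) -
        (ε - groundEnergy S.ham_isHermitian) - 3 * S.bdSize L)) := by
  have hham : S.ham = S.hamOut L + S.hamIn L + S.hamBd L := by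
    rw [S.ham_eq L]; abel
  have hCA : S.hamOut L + S.hamIn L = ∑ X ∈ outside L ∪ inside L, S.h X := by
    rw [Finset.sum_union]
    · rfl
    · exact Finset.disjoint_left.mpr fun X h1 h2 =>
        (Finset.mem_filter.mp h1).2.1 (Finset.mem_filter.mp h2).2
  have h1 := norm_exp_mul_spectralProj_le (S.hamIn_isHermitian L) (S.hamBd_isHermitian L)
    (S.hamOut_isHermitian L) (S.commute_hamIn_hamOut L) (b := S.bdSize L) (ε := ε) hlam.le
    (fun _ hx => groundEnergy_le_of_mem_spectrum (S.hamOut_isHermitian L) hx) (by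
      intro t ht0 ht
      rw [hCA]
      refine S.norm_exp_conj_hamBd_le hg _ L ht0 (le_trans ?_ hlamgk)
      gcongr)
  rw [← hham] at h1
  have h2 := norm_sub_cfc_min_mul_le (S.hamIn_isHermitian L) hlam τ
    (spectralProj S.ham (Set.Icc 0 ε))
  rw [ham_sub_truncHam]
  refine h2.trans ?_
  rw [mul_assoc]
  gcongr
  refine (mul_le_mul_of_nonneg_left h1 (Real.exp_pos _).le).trans ?_
  rw [← Real.exp_add, Real.exp_le_exp]
  -- Two of the three boundary terms come from the interaction picture; the product state supplies
  -- the third.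
  have h3 := S.groundEnergy_ham_le L
  nlinarith

theorem norm_ham_sub_mul_spectralProj_truncHam_le [NeZero d] (S : SpinSystem Λ d k g)
    (hg : 0 ≤ g) {lam : ℝ} (hlam : 0 < lam) (hlam2 : lam ≤ 1 / 2)
    (hlamgk : lam * (g * k) ≤ 1 / 2) (L : Finset Λ) (τ ε : ℝ) {η : ℝ}
    (hη : η = τ - groundEnergy (S.hamIn_isHermitian L) -
      (ε - groundEnergy (S.truncHam_isHermitian L τ)) - 33 * S.bdSize L) (hη0 : 0 < η) :
    ‖(S.ham - S.truncHam L τ) * spectralProj (S.truncHam L τ) (Set.Icc 0 ε)‖ ≤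
      6 / lam * Real.exp (-lam * η) := by
  have hb := S.bdSize_nonneg L
  -- Taking δ ≤ η keeps the threshold a below τ, and δ ≤ 1 limits its cost to e^{λδ} ≤ e^{1/2} ≤ 3.
  -- With the factor 2 from the Sylvester estimate this gives the constant 6.
  have hδ : 0 < min 1 η := lt_min one_pos hη0
  have hδ1 : min 1 η ≤ 1 := min_le_left _ _
  have hδη : min 1 η ≤ η := min_le_right _ _
  have h3 := S.groundEnergy_ham_le L
  have h4 : groundEnergy (S.truncHam_isHermitian L τ) ≤ groundEnergy S.ham_isHermitian :=
    energyLevel_le_energyLevel _ _ (S.energy_truncHam_le L τ) _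
  have h1 := norm_exp_mul_spectralProj_truncated_le (S.hamIn_isHermitian L)
    (S.hamBd_isHermitian L) (S.hamOut_isHermitian L) (S.commute_hamIn_hamOut L)
    (b := S.bdSize L) (ε := ε) (τ := τ) hlam.le hb hδ
    (fun _ hx => groundEnergy_le_of_mem_spectrum (S.hamOut_isHermitian L) hx)
    (S.norm_exp_conj_hamBd_le hg (inside L) L hlam.le hlamgk) (by linarith)
  rw [← truncIn_eq] at h1
  have h2 := norm_sub_cfc_min_mul_le (S.hamIn_isHermitian L) hlam τ
    (spectralProj (S.truncHam L τ) (Set.Icc 0 ε))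
  rw [ham_sub_truncHam]
  refine h2.trans ?_
  have h5 : Real.exp (1 / 2) ≤ 3 := by
    have h6 : Real.exp (1 / 2) ≤ Real.exp 1 := Real.exp_le_exp.mpr (by norm_num)
    linarith [Real.exp_one_lt_d9]
  set a := ε - groundEnergy (S.hamOut_isHermitian L) + 4 * S.bdSize L + min 1 η with ha
  have h7 : -lam * τ + lam * a ≤ 1 / 2 + -lam * η := by
    have : a - τ ≤ 1 - η := by linarith
    nlinarith
  calc _ ≤ 1 / lam * Real.exp (-lam * τ) * (2 * Real.exp (lam * a)) := by
        gcongr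
        exact h1
    _ = 2 / lam * Real.exp (-lam * τ + lam * a) := by rw [Real.exp_add]; ring
    _ ≤ 2 / lam * Real.exp (1 / 2 + -lam * η) := by gcongr
    _ = 2 / lam * Real.exp (1 / 2) * Real.exp (-lam * η) := by rw [Real.exp_add]; ring
    _ ≤ 2 / lam * 3 * Real.exp (-lam * η) := by gcongr
    _ = _ := by ring

end SpinSystem

end

/-! ### The theorem -/

theorem theorem4 {Λ : Type*} [Fintype Λ] [DecidableEq Λ] (d k : ℕ) [NeZero d] (g lam : ℝ)
    (hgk : 1 ≤ g * k) (hlam : lam = 1 / (2 * g * k))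
    (S : SpinSystem Λ d k g) (L : Finset Λ) (τ : ℝ) (hτ : 0 < τ)
    (ε Δτ Δε Δε' : ℝ)
    (hΔτ : Δτ = τ - groundEnergy (S.hamIn_isHermitian L))
    (hΔε : Δε = ε - groundEnergy S.ham_isHermitian)
    (hΔε' : Δε' = ε - groundEnergy (S.truncHam_isHermitian L τ)) :
    (‖(S.ham - S.truncHam L τ) * spectralProj S.ham (Set.Icc 0 ε)‖
        ≤ 6 / lam ^ (3 / 2 : ℝ) * Real.exp (-lam * (Δτ - Δε - 3 * S.bdSize L))) ∧
    (0 < Δτ - Δε' - 33 * S.bdSize L →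
      ‖(S.ham - S.truncHam L τ) * spectralProj (S.truncHam L τ) (Set.Icc 0 ε)‖
        ≤ 6 / lam ^ (3 / 2 : ℝ) * Real.exp (-lam * (Δτ - Δε' - 33 * S.bdSize L))) ∧
    (∀ j : Fin (Fintype.card (Config Λ d)), energyLevel S.ham_isHermitian j ≤ ε →
      energyLevel S.ham_isHermitian j
          - 6 / lam ^ (3 / 2 : ℝ) * Real.exp (-lam * (Δτ - Δε' - 33 * S.bdSize L))
        ≤ energyLevel (S.truncHam_isHermitian L τ) j ∧
      energyLevel (S.truncHam_isHermitian L τ) j ≤ energyLevel S.ham_isHermitian j) := by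
  have hk : 0 ≤ (k : ℝ) := Nat.cast_nonneg k
  have hg : 0 ≤ g := by
    by_contra! h
    nlinarith
  have hpos : 0 < 2 * g * k := by linarith
  have hlam0 : 0 < lam := by rw [hlam]; positivity
  have hlam2 : lam ≤ 1 / 2 := by
    rw [hlam]
    exact one_div_le_one_div_of_le two_pos (by linarith)
  have hlamgk : lam * (g * k) ≤ 1 / 2 := by
    rw [hlam, one_div, inv_mul_le_iff₀ hpos]
    linarith
  have hpow : lam ^ (3 / 2 : ℝ) ≤ lam := by
    simpa using Real.rpow_le_rpow_of_exponent_ge hlam0 (by linarith : lam ≤ 1)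
      (by norm_num : (1 : ℝ) ≤ 3 / 2)
  have hpow0 : 0 < lam ^ (3 / 2 : ℝ) := Real.rpow_pos_of_pos hlam0 _
  have hconst : 6 / lam ≤ 6 / lam ^ (3 / 2 : ℝ) := by gcongr
  have hconst' : 1 / lam ≤ 6 / lam ^ (3 / 2 : ℝ) := by
    refine le_trans ?_ hconst
    gcongr
    norm_num
  have hb := S.bdSize_nonneg L
  -- The energy is left free because part (ii) uses the bound at the truncated level itself instead
  -- of ε.
  have htrunc : ∀ ε' : ℝ, 0 < Δτ - (ε' - groundEnergy (S.truncHam_isHermitian L τ)) -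
      33 * S.bdSize L →
      ‖(S.ham - S.truncHam L τ) * spectralProj (S.truncHam L τ) (Set.Icc 0 ε')‖ ≤
        6 / lam ^ (3 / 2 : ℝ) * Real.exp (-lam * (Δτ - (ε' -
          groundEnergy (S.truncHam_isHermitian L τ)) - 33 * S.bdSize L)) := fun ε' h =>
    (S.norm_ham_sub_mul_spectralProj_truncHam_le hg hlam0 hlam2 hlamgk L τ ε'
      (by rw [hΔτ]) h).trans (by gcongr)
  refine ⟨?_, ?_, fun j hj => ⟨?_, ?_⟩⟩
  · have h1 := S.norm_ham_sub_mul_spectralProj_ham_le hg hlam0 hlamgk L τ ε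
    rw [← hΔτ, ← hΔε] at h1
    exact h1.trans (mul_le_mul_of_nonneg_right hconst' (Real.exp_pos _).le)
  · intro h
    rw [hΔε'] at h ⊢
    exact htrunc ε h
  · set μ := energyLevel (S.truncHam_isHermitian L τ) j with hμ
    have hle : μ ≤ energyLevel S.ham_isHermitian j :=
      energyLevel_le_energyLevel _ _ (S.energy_truncHam_le L τ) j
    -- Part (ii) carries no sign condition. If the exponent at μ is not negative, the bound holds
    -- trivially: ε_j - μ ≤ ε - μ ≤ -η ≤ λ⁻¹ e^{-λη}.
    rcases lt_or_ge 0 (Δτ - (μ - groundEnergy (S.truncHam_isHermitian L τ)) -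
      33 * S.bdSize L) with h | h
    · have h1 := energyLevel_le_add_norm S.ham_isHermitian (S.truncHam_isHermitian L τ) j
        (I := Set.Icc 0 μ) fun i hi =>
          ⟨S.energyLevel_truncHam_nonneg L hτ.le i, energyLevel_mono _ hi⟩
      have h2 := htrunc μ h
      have h3 : Real.exp (-lam * (Δτ - (μ - groundEnergy (S.truncHam_isHermitian L τ)) -
          33 * S.bdSize L)) ≤ Real.exp (-lam * (Δτ - Δε' - 33 * S.bdSize L)) := by
        rw [Real.exp_le_exp, hΔε']
        nlinarith
      have h4 := h2.trans (mul_le_mul_of_nonneg_left h3 (by positivity))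
      linarith
    · set η := Δτ - Δε' - 33 * S.bdSize L with hη
      have h1 : energyLevel S.ham_isHermitian j - μ ≤ -η := by
        rw [hη, hΔε']
        linarith
      have h2 : -η ≤ 1 / lam * Real.exp (-lam * η) := by
        rw [one_div, ← div_eq_inv_mul, le_div_iff₀ hlam0]
        linarith [Real.add_one_le_exp (-lam * η)]
      have h3 : 1 / lam * Real.exp (-lam * η) ≤
          6 / lam ^ (3 / 2 : ℝ) * Real.exp (-lam * η) :=
        mul_le_mul_of_nonneg_right hconst' (Real.exp_pos _).le
      linarith
  · exact energyLevel_le_energyLevel _ _ (S.energy_truncHam_le L τ) j
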